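/- Let $\Delta=\mathbb{R}$ or $\Delta=\mathbb{C}$, equipped with Lebesgue measure $dx$, let $\beta>0$, and let $V:\Delta\to\mathbb{R}$ be continuous. Assume the weak growth condition: there is $\beta'>1$ with $\beta'\ge\beta$ such that $$\liminf_{|x|\to\infty}\big\{V(x)-\beta'\log|x|\big\}>-\infty .$$ For $N\ge 1$ put $$Z_N=\int_{\Delta^N}\prod_{1\le i<j\le N}|x_i-x_j|^\beta\prod_{i=1}^N e^{-NV(x_i)}\,dx_1\cdots dx_N ,$$ and, if $\Delta=\mathbb{C}$, assume moreover that $Z_N<+\infty$ for all $N\ge1$. Then, for every $N\ge 1$, $$d\mathbb{P}_N(x_1,\dots,x_N)=\frac1{Z_N}\prod_{1\le i<j\le N}|x_i-x_j|^\beta\prod_{i=1}^N e^{-NV(x_i)}\,dx_1\cdots dx_N$$ is a well-defined probability measure on $\Delta^N$. The functional $$I_V(\mu)=\iint\Big(\frac\beta2\log\frac1{|x-y|}+\frac12V(x)+\frac12V(y)\Big)d\mu(x)\,d\mu(y)\in(-\infty,+\infty]$$ (where the integrand is $+\infty$ for $x=y$) has a unique minimizer $\mu_V^*$ on the set $\mathcal{M}_1(\Delta)$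 of Borel probability measures on $\Delta$. Finally, let $\mathbb{P}=\bigotimes_{N\ge1}\mathbb{P}_N$ be the product probability measure on $\prod_{N\ge1}\Delta^N$ and let $\mu^N=\frac1N\sum_{i=1}^N\delta_{x_i}$ be the empirical measure of the $N$-th component $(x_1,\dots,x_N)\in\Delta^N$. Then $$\mathbb{P}\Big(\mu^N\text{ converges weakly as }N\to\infty\text{ to }\mu_V^*\Big)=1 .$$ -/

import Mathlib

open MeasureTheory Filter Topology
open scoped ENNReal

noncomputable section

namespace CoulombGas

section Gas

variable {E : Type*} [NormedAddCommGroup E]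

/-- The weak growth condition `liminf_{|x| → ∞} (V x - β' log |x|) > -∞`. -/
def WeakGrowth (β' : ℝ) (V : E → ℝ) : Prop :=
  (⊥ : EReal) <
    liminf (fun x : E => ((V x - β' * Real.log ‖x‖ : ℝ) : EReal)) (Bornology.cobounded E)

/-- The unnormalized density
`∏_{i < j} |x_i - x_j|^β ∏_i exp (- N V (x_i))` of the gas of `N` particles. -/
def gasWeight (β : ℝ) (V : E → ℝ) (N : ℕ) (x : Fin N → E) : ℝ :=
  (∏ i : Fin N, ∏ j ∈ Finset.Ioi i, ‖x i - x j‖ ^ β) *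
    ∏ i : Fin N, Real.exp (-((N : ℝ) * V (x i)))

/-- The partition function `Z_N`, with respect to the Lebesgue measure of `E ^ N`. -/
def partitionFunction [MeasureSpace E] (β : ℝ) (V : E → ℝ) (N : ℕ) : ℝ≥0∞ :=
  ∫⁻ x : Fin N → E, ENNReal.ofReal (gasWeight β V N x)

/-- The law `ℙ_N` on `E ^ N`, with density `gasWeight / Z_N` with respect to Lebesgue measure. -/
def gasMeasure [MeasureSpace E] (β : ℝ) (V : E → ℝ) (N : ℕ) : Measure (Fin N → E) :=
  (partitionFunction β V N)⁻¹ •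
    (volume : Measure (Fin N → E)).withDensity (fun x => ENNReal.ofReal (gasWeight β V N x))

/-- The product measure `ℙ = ⨂_N ℙ_N` on `∏_{N ≥ 1} E ^ N`. -/
def jointMeasure [MeasureSpace E] (β : ℝ) (V : E → ℝ) :
    Measure ((N : ℕ+) → Fin (N : ℕ) → E) :=
  Measure.infinitePi (fun N : ℕ+ => gasMeasure β V (N : ℕ))

/-- The empirical measure `μ^N = (1 / N) ∑_i δ_{x_i}`, as a probability measure. -/
def empiricalMeasure [MeasurableSpace E] (N : ℕ+) (x : Fin (N : ℕ) → E) : ProbabilityMeasure E :=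
  ⟨((N : ℕ) : ℝ≥0∞)⁻¹ • ∑ i : Fin (N : ℕ), Measure.dirac (x i), ⟨by
    have h0 : ((N : ℕ) : ℝ≥0∞) ≠ 0 := by simp
    simpa [Measure.finsetSum_apply] using
      ENNReal.inv_mul_cancel h0 (ENNReal.natCast_ne_top (N : ℕ))⟩⟩

open scoped Classical in
/-- The weighted logarithmic kernel
`F_V (x, y) = (β / 2) log (1 / |x - y|) + V x / 2 + V y / 2`, equal to `+∞` for `x = y`. -/
def kernel (β : ℝ) (V : E → ℝ) (x y : E) : EReal :=
  if x = y then ⊤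
  else ((β / 2 * Real.log (1 / ‖x - y‖) + 1 / 2 * V x + 1 / 2 * V y : ℝ) : EReal)

/-- The weighted logarithmic energy `I_V (μ) = ∬ F_V (x, y) dμ(x) dμ(y)`: the integral of the
positive part minus the integral of the negative part. (Under the weak growth condition with
`β ≤ β'` the kernel is bounded below, so that the second integral is finite.) -/
def energy [MeasurableSpace E] (β : ℝ) (V : E → ℝ) (μ : ProbabilityMeasure E) : EReal :=
  ((∫⁻ z : E × E, (kernel β V z.1 z.2).toENNReal ∂((μ : Measure E).prod (μ : Measure E)) : ℝ≥0∞)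
      : EReal) -
    ((∫⁻ z : E × E, (-kernel β V z.1 z.2).toENNReal ∂((μ : Measure E).prod (μ : Measure E)) : ℝ≥0∞)
      : EReal)

/-- `μ` is the unique minimizer of `I_V` on the probability measures on `E`. -/
def IsUniqueMinimizer [MeasurableSpace E] (β : ℝ) (V : E → ℝ) (μ : ProbabilityMeasure E) : Prop :=
  (∀ ν : ProbabilityMeasure E, energy β V μ ≤ energy β V ν) ∧
    ∀ μ' : ProbabilityMeasure E,
      (∀ ν : ProbabilityMeasure E, energy β V μ' ≤ energy β V ν) → μ' = μ

end Gas

end CoulombGas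

end

noncomputable section

namespace CoulombGas

set_option linter.unusedSectionVars false

/-! ### Strict positive definiteness of the Gaussian kernel -/

section Gaussian

open Complex ComplexConjugate
open scoped RealInnerProductSpace

variable {H : Type*} [NormedAddCommGroup H] [InnerProductSpace ℝ H] [FiniteDimensional ℝ H]
  [MeasurableSpace H] [BorelSpace H]

/-! Growth gives V(x) ≥ (β/2) log(1+|x|²) − C, and |x−y|² ≤ (1+|x|²)(1+|y|²) always holds. Hence F_V
+ C ≥ 0: it is −log of a continuous factor `pairWeight` with values in [0,1], which vanishes on the
diagonal and is small as soon as both points are far away. The shifted energy J = I_V + C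
(`mutualEnergy`) is then an integral with values in [0,∞], and everything is proved for J.

Uniqueness of the minimizer. After inverse stereographic projection, F_V + C is a sum of two
nonnegative one-particle terms and (β/4)(−log q), with q ≤ 1 the squared chordal distance.
Frullani's formula −log q = ∫₀^∞ (e^{−tq} − e^{−t}) dt/t makes the last term a mixture of Gaussian
kernels in the Euclidean space around the sphere. These are strictly positive definite by Fourier
inversion (`two_mul_gaussianEnergy_lt`), so J at a midpoint of two distinct measures of finite
energy is below the average (`two_mul_mutualEnergy_lt`).

Existence and stability. Truncating the kernel at height M gives a weakly continuous energy
increasing to J with M. Asymptotic bounds on the truncated energies force tightness, so a sequence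
whose truncated energies are asymptotically at most min J converges to the minimizer
(`tendsto_minimizer`). Truncation also makes the diagonal harmless: for an empirical measure it
contributes at most M/N.

Probability. Of the N copies of V(x_i), N−1 are absorbed into the pair factors and one is left over,
so the gas density is e^{CN(N−1)} · `interaction` · ∏ e^{−V(x_i)}. The leftover factor is
integrable: on ℝ because β' > 1, on ℂ because Z_1 < ∞. Configurations with `interaction` ≤ e^{−N²r}
thus have mass at most e^{CN(N−1)} e^{−N²r} K^N, where K = ∫ e^{−V}. Conversely, Jensen's inequality
under η^{⊗N}, for η compactly supported with bounded density, gives Z_N ≥ e^{CN(N−1)}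
e^{−N²J(η)−O(N)} (`le_partitionFunction`). Smoothing shows that J(η) < r is possible whenever r >
min J (`exists_regular_mutualEnergy_lt`). The bad configurations therefore have probability
O(e^{−N}), and Borel–Cantelli along r ↓ min J concludes. -/

lemma charFun_mul_conj_charFun (μ ν : Measure H) [IsFiniteMeasure μ] [IsFiniteMeasure ν] (ξ : H) :
    charFun μ ξ * conj (charFun ν ξ) =
      ∫ z : H × H, cexp (⟪z.1 - z.2, ξ⟫ * I) ∂(μ.prod ν) := by
  rw [← charFun_neg, charFun_apply, charFun_apply, ← integral_prod_mul]
  congr 1 with z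
  rw [← Complex.exp_add, inner_sub_left, inner_neg_right]
  push_cast
  ring_nf

lemma integrable_gaussian {b : ℝ} (hb : 0 < b) :
    Integrable (fun ξ : H => Real.exp (-b * ‖ξ‖ ^ 2)) := by
  have h := GaussianFourier.integrable_cexp_neg_mul_sq_norm_add (V := H) (b := (b : ℂ))
    (by simpa using hb) 0 0
  refine (h.norm).congr ?_
  filter_upwards with ξ
  rw [Complex.norm_exp]
  congr 1
  simp [← Complex.ofReal_pow]

/-- The Gaussian energy of two finite measures, expressed through characteristic functions. -/
lemma integral_charFun_mul_conj (μ ν : Measure H) [IsFiniteMeasure μ] [IsFiniteMeasure ν]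
    {b : ℝ} (hb : 0 < b) :
    ∫ ξ : H, charFun μ ξ * conj (charFun ν ξ) * (Real.exp (-b * ‖ξ‖ ^ 2) : ℂ) =
      ((Real.pi / b) ^ (Module.finrank ℝ H / 2 : ℝ) *
        ∫ z : H × H, Real.exp (-(‖z.1 - z.2‖ ^ 2 / (4 * b))) ∂(μ.prod ν) : ℝ) := by
  have hint : Integrable (Function.uncurry fun (ξ : H) (z : H × H) =>
      cexp (⟪z.1 - z.2, ξ⟫ * I) * (Real.exp (-b * ‖ξ‖ ^ 2) : ℂ)) (volume.prod (μ.prod ν)) := by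
    have h1 : Integrable (fun w : H × (H × H) => Real.exp (-b * ‖w.1‖ ^ 2) * 1)
        (volume.prod (μ.prod ν)) :=
      (integrable_gaussian hb).mul_prod (integrable_const 1)
    refine h1.mono' ?_ ?_
    · exact (by fun_prop : Continuous fun w : H × (H × H) =>
        cexp (⟪w.2.1 - w.2.2, w.1⟫ * I) * (Real.exp (-b * ‖w.1‖ ^ 2) : ℂ)).aestronglyMeasurable
    · filter_upwards with w
      simp only [Function.uncurry, norm_mul, Complex.norm_exp_ofReal_mul_I, one_mul, mul_one,
        Complex.norm_real, Real.norm_eq_abs, Real.abs_exp, le_refl]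
  simp_rw [charFun_mul_conj_charFun, ← integral_mul_const]
  rw [integral_integral_swap hint]
  have key : ∀ w : H, ∫ ξ : H, cexp (⟪w, ξ⟫ * I) * (Real.exp (-b * ‖ξ‖ ^ 2) : ℂ) =
      ((Real.pi / b) ^ (Module.finrank ℝ H / 2 : ℝ) * Real.exp (-(‖w‖ ^ 2 / (4 * b))) : ℝ) := by
    intro w
    have h := GaussianFourier.integral_cexp_neg_mul_sq_norm_add (V := H) (b := (b : ℂ))
      (by simpa using hb) I w
    have h2 : ∀ ξ : H, cexp (⟪w, ξ⟫ * I) * (Real.exp (-b * ‖ξ‖ ^ 2) : ℂ) =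
        cexp (-(b : ℂ) * ‖ξ‖ ^ 2 + I * ⟪w, ξ⟫) := by
      intro ξ
      rw [Complex.exp_add, mul_comm]
      push_cast
      ring_nf
    simp_rw [h2, h]
    rw [Complex.ofReal_mul, Complex.ofReal_cpow (by positivity)]
    push_cast
    rw [Complex.I_sq]
    ring_nf
  simp_rw [key]
  rw [integral_complex_ofReal, integral_const_mul]

/-- The energy of a pair of measures for the Gaussian kernel. -/
def gaussianEnergy (t : ℝ) (μ ν : Measure H) : ℝ :=
  ∫ z : H × H, Real.exp (-(t * ‖z.1 - z.2‖ ^ 2)) ∂(μ.prod ν)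

lemma gaussianEnergy_comm (t : ℝ) (μ ν : Measure H) [IsFiniteMeasure μ] [IsFiniteMeasure ν] :
    gaussianEnergy t μ ν = gaussianEnergy t ν μ := by
  unfold gaussianEnergy
  rw [← integral_prod_swap]
  simp [norm_sub_rev]

/-- By Fourier transform, the Gaussian quadratic form of μ − ν is a weighted squared L² norm of the
difference of characteristic functions. The weight e^{−b|ξ|²} transforms to a multiple of
e^{−|w|²/(4b)}, which dictates b = 1/(4t). -/
lemma exists_gaussianEnergy_eq {t : ℝ} (ht : 0 < t) :
    ∃ b c : ℝ, 0 < b ∧ 0 < c ∧ ∀ (μ ν : Measure H) [IsFiniteMeasure μ] [IsFiniteMeasure ν],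
      c * (gaussianEnergy t μ μ + gaussianEnergy t ν ν - 2 * gaussianEnergy t μ ν) =
        ∫ ξ : H, ‖charFun μ ξ - charFun ν ξ‖ ^ 2 * Real.exp (-b * ‖ξ‖ ^ 2) := by
  refine ⟨1 / (4 * t), (Real.pi / (1 / (4 * t))) ^ (Module.finrank ℝ H / 2 : ℝ), by positivity,
    by positivity, fun μ ν _ _ => ?_⟩
  set b := 1 / (4 * t) with hbdef
  have hb : 0 < b := by positivity
  set c := (Real.pi / b) ^ (Module.finrank ℝ H / 2 : ℝ)
  have h : ∀ (μ ν : Measure H) [IsFiniteMeasure μ] [IsFiniteMeasure ν],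
      ∫ ξ : H, charFun μ ξ * conj (charFun ν ξ) * (Real.exp (-b * ‖ξ‖ ^ 2) : ℂ) =
        (c * gaussianEnergy t μ ν : ℝ) := by
    intro μ ν _ _
    rw [integral_charFun_mul_conj μ ν hb]
    unfold gaussianEnergy
    congr 4 with z
    rw [hbdef]
    congr 2
    field_simp
  have hi : ∀ (μ ν : Measure H) [IsFiniteMeasure μ] [IsFiniteMeasure ν],
      Integrable fun ξ : H => charFun μ ξ * conj (charFun ν ξ) * (Real.exp (-b * ‖ξ‖ ^ 2) : ℂ) := by
    intro μ ν _ _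
    refine ((integrable_gaussian (H := H) hb).const_mul
      (μ.real Set.univ * ν.real Set.univ)).mono' ?_ ?_
    · have h1 := continuous_charFun (μ := μ)
      have h2 := continuous_charFun (μ := ν)
      exact (by fun_prop : Continuous fun ξ : H => charFun μ ξ * conj (charFun ν ξ) *
        (Real.exp (-b * ‖ξ‖ ^ 2) : ℂ)).aestronglyMeasurable
    · filter_upwards with ξ
      rw [norm_mul, norm_mul, Complex.norm_real, Real.norm_eq_abs, Real.abs_exp, RCLike.norm_conj]
      have h1 := norm_charFun_le (μ := μ) ξ
      have h2 := norm_charFun_le (μ := ν) ξ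
      gcongr
  have h3 : ∀ ξ : H, ((‖charFun μ ξ - charFun ν ξ‖ ^ 2 * Real.exp (-b * ‖ξ‖ ^ 2) : ℝ) : ℂ) =
      charFun μ ξ * conj (charFun μ ξ) * (Real.exp (-b * ‖ξ‖ ^ 2) : ℂ) +
      charFun ν ξ * conj (charFun ν ξ) * (Real.exp (-b * ‖ξ‖ ^ 2) : ℂ) -
      (charFun μ ξ * conj (charFun ν ξ) * (Real.exp (-b * ‖ξ‖ ^ 2) : ℂ) +
      charFun ν ξ * conj (charFun μ ξ) * (Real.exp (-b * ‖ξ‖ ^ 2) : ℂ)) := by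
    intro ξ
    rw [Complex.ofReal_mul, Complex.ofReal_pow, ← Complex.mul_conj', map_sub]
    ring
  apply Complex.ofReal_injective
  rw [← integral_complex_ofReal]
  simp_rw [h3]
  have hsub := integral_sub ((hi μ μ).add (hi ν ν)) ((hi μ ν).add (hi ν μ))
  simp only [Pi.add_apply] at hsub
  rw [hsub, integral_add (hi μ μ) (hi ν ν), integral_add (hi μ ν) (hi ν μ), h, h, h, h,
    gaussianEnergy_comm t ν μ]
  push_cast
  ring

lemma two_mul_gaussianEnergy_le {t : ℝ} (ht : 0 < t) (μ ν : Measure H) [IsFiniteMeasure μ]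
    [IsFiniteMeasure ν] :
    2 * gaussianEnergy t μ ν ≤ gaussianEnergy t μ μ + gaussianEnergy t ν ν := by
  obtain ⟨b, c, hb, hc, h⟩ := exists_gaussianEnergy_eq (H := H) ht
  have h1 : 0 ≤ c * (gaussianEnergy t μ μ + gaussianEnergy t ν ν - 2 * gaussianEnergy t μ ν) := by
    rw [h]
    exact integral_nonneg fun ξ => by positivity
  nlinarith [nonneg_of_mul_nonneg_right h1 hc]

/-- Characteristic functions are continuous and determine the measure, so for μ ≠ ν the integrand
above is positive on a nonempty open set. -/
lemma two_mul_gaussianEnergy_lt {t : ℝ} (ht : 0 < t) {μ ν : Measure H} [IsFiniteMeasure μ]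
    [IsFiniteMeasure ν] (hne : μ ≠ ν) :
    2 * gaussianEnergy t μ ν < gaussianEnergy t μ μ + gaussianEnergy t ν ν := by
  obtain ⟨b, c, hb, hc, h⟩ := exists_gaussianEnergy_eq (H := H) ht
  have h1 : 0 < c * (gaussianEnergy t μ μ + gaussianEnergy t ν ν - 2 * gaussianEnergy t μ ν) := by
    rw [h]
    have hcont : Continuous fun ξ : H =>
        ‖charFun μ ξ - charFun ν ξ‖ ^ 2 * Real.exp (-b * ‖ξ‖ ^ 2) := by
      have h1 := continuous_charFun (μ := μ)
      have h2 := continuous_charFun (μ := ν)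
      fun_prop
    have hint : Integrable fun ξ : H =>
        ‖charFun μ ξ - charFun ν ξ‖ ^ 2 * Real.exp (-b * ‖ξ‖ ^ 2) := by
      refine ((integrable_gaussian (H := H) hb).const_mul
        ((μ.real Set.univ + ν.real Set.univ) ^ 2)).mono' hcont.aestronglyMeasurable ?_
      filter_upwards with ξ
      rw [Real.norm_of_nonneg (by positivity)]
      have h1 := norm_charFun_le (μ := μ) ξ
      have h2 := norm_charFun_le (μ := ν) ξ
      have h3 := norm_sub_le (charFun μ ξ) (charFun ν ξ)
      gcongr
      linarith
    rw [integral_pos_iff_support_of_nonneg (fun ξ => by positivity) hint]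
    refine (hcont.isOpen_support).measure_pos _ ?_
    by_contra hempty
    rw [Set.not_nonempty_iff_eq_empty, Function.support_eq_empty_iff] at hempty
    refine hne (Measure.ext_of_charFun (funext fun ξ => ?_))
    have := congrFun hempty ξ
    simpa [sub_eq_zero, Real.exp_ne_zero] using this
  nlinarith [pos_of_mul_pos_right h1 hc.le]

end Gaussian

/-! ### The extended function −log and Frullani's formula -/

section NegLog

/-- The function `-log` with values in `[0, ∞]`, equal to `∞` at `r ≤ 0`. -/
def negLog (r : ℝ) : ℝ≥0∞ := if r ≤ 0 then ⊤ else ENNReal.ofReal (-Real.log r)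

@[simp] lemma negLog_zero : negLog 0 = ⊤ := by simp [negLog]

lemma negLog_of_pos {r : ℝ} (hr : 0 < r) : negLog r = ENNReal.ofReal (-Real.log r) := by
  simp [negLog, not_le.2 hr]

@[fun_prop]
lemma measurable_negLog : Measurable negLog :=
  Measurable.ite measurableSet_Iic measurable_const (by fun_prop)

lemma negLog_antitone : Antitone negLog := by
  intro a b hab
  rcases le_or_gt a 0 with ha | ha
  · simp [negLog, ha]
  · rw [negLog_of_pos ha, negLog_of_pos (ha.trans_le hab)]
    exact ENNReal.ofReal_le_ofReal (neg_le_neg (Real.log_le_log ha hab))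

/-- The bounds by 1 keep both logarithms nonpositive, so that `ENNReal.ofReal` truncates nothing. -/
lemma negLog_mul {a b : ℝ} (ha : 0 ≤ a) (ha1 : a ≤ 1) (hb : 0 ≤ b) (hb1 : b ≤ 1) :
    negLog (a * b) = negLog a + negLog b := by
  rcases ha.eq_or_lt with rfl | ha
  · simp
  rcases hb.eq_or_lt with rfl | hb
  · simp
  rw [negLog_of_pos ha, negLog_of_pos hb, negLog_of_pos (mul_pos ha hb), ← ENNReal.ofReal_add,
    Real.log_mul ha.ne' hb.ne']
  · ring_nf
  · linarith [Real.log_nonpos ha.le ha1]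
  · linarith [Real.log_nonpos hb.le hb1]

lemma negLog_rpow {a c : ℝ} (ha : 0 ≤ a) (hc : 0 < c) :
    negLog (a ^ c) = ENNReal.ofReal c * negLog a := by
  rcases ha.eq_or_lt with rfl | ha
  · rw [Real.zero_rpow hc.ne', negLog_zero, ENNReal.mul_top (by simpa using hc)]
  rw [negLog_of_pos ha, negLog_of_pos (Real.rpow_pos_of_pos ha c), ← ENNReal.ofReal_mul hc.le,
    Real.log_rpow ha]
  ring_nf

lemma negLog_exp_neg (r : ℝ) : negLog (Real.exp (-r)) = ENNReal.ofReal r := by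
  rw [negLog_of_pos (Real.exp_pos _), Real.log_exp, neg_neg]

lemma lintegral_inv_Ioc {q : ℝ} (hq : 0 < q) (hq1 : q ≤ 1) :
    ∫⁻ s in Set.Ioc q 1, ENNReal.ofReal s⁻¹ = negLog q := by
  rw [negLog_of_pos hq, ← Real.log_inv]
  have h : ∫ s in q..1, s⁻¹ = Real.log q⁻¹ := by
    rw [integral_inv_of_pos hq one_pos, one_div]
  rw [← h, intervalIntegral.integral_of_le hq1, ofReal_integral_eq_lintegral_ofReal]
  · have : IntervalIntegrable (fun s : ℝ => s⁻¹) volume q 1 := by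
      apply intervalIntegral.intervalIntegrable_inv
      · intro x hx
        rw [Set.uIcc_of_le hq1] at hx
        exact (hq.trans_le hx.1).ne'
      · exact continuousOn_id
    exact (intervalIntegrable_iff_integrableOn_Ioc_of_le hq1).1 this
  · filter_upwards [ae_restrict_mem measurableSet_Ioc] with s hs
    exact inv_nonneg.2 (hq.trans hs.1).le

lemma lintegral_inv_Ioc_eq_negLog {q : ℝ} (hq : 0 ≤ q) (hq1 : q ≤ 1) :
    ∫⁻ s in Set.Ioc q 1, ENNReal.ofReal s⁻¹ = negLog q := by
  rcases hq.eq_or_lt with rfl | hq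
  · rw [negLog_zero]
    refine ENNReal.eq_top_of_forall_nnreal_le fun r => ?_
    have h1 : Real.exp (-r) ≤ 1 := by simp
    calc (r : ℝ≥0∞) = negLog (Real.exp (-r)) := by rw [negLog_exp_neg]; simp
      _ = ∫⁻ s in Set.Ioc (Real.exp (-r)) 1, ENNReal.ofReal s⁻¹ :=
        (lintegral_inv_Ioc (Real.exp_pos _) h1).symm
      _ ≤ _ := lintegral_mono_set (Set.Ioc_subset_Ioc_left (Real.exp_pos _).le)
  · exact lintegral_inv_Ioc hq hq1

lemma lintegral_exp_neg_mul_Ioi {s : ℝ} (hs : 0 < s) :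
    ∫⁻ t in Set.Ioi (0 : ℝ), ENNReal.ofReal (Real.exp (-(t * s))) = ENNReal.ofReal s⁻¹ := by
  have hint := integrableOn_exp_mul_Ioi (a := -s) (by linarith) 0
  have h := integral_exp_mul_Ioi (a := -s) (by linarith) 0
  have he : ∀ t : ℝ, -(t * s) = -s * t := fun t => by ring
  simp_rw [he]
  rw [← ofReal_integral_eq_lintegral_ofReal hint (ae_of_all _ fun t => (Real.exp_pos _).le), h]
  simp

lemma lintegral_exp_neg_mul_Ioc {q t : ℝ} (hq1 : q ≤ 1) (ht : 0 < t) :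
    ∫⁻ s in Set.Ioc q 1, ENNReal.ofReal (Real.exp (-(t * s))) =
      ENNReal.ofReal ((Real.exp (-(t * q)) - Real.exp (-t)) / t) := by
  have hint : IntervalIntegrable (fun s : ℝ => Real.exp (-(t * s))) volume q 1 :=
    (by fun_prop : Continuous fun s : ℝ => Real.exp (-(t * s))).intervalIntegrable _ _
  have h : ∫ s in q..1, Real.exp (-(t * s)) = (Real.exp (-(t * q)) - Real.exp (-t)) / t := by
    have h1 := intervalIntegral.integral_comp_mul_left (a := q) (b := 1)
      (fun x => Real.exp x) (c := -t) (by linarith)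
    simp only [neg_mul] at h1
    rw [h1, integral_exp]
    simp only [smul_eq_mul, mul_one]
    field_simp
    ring
  rw [← h, intervalIntegral.integral_of_le hq1, ofReal_integral_eq_lintegral_ofReal]
  · exact (intervalIntegrable_iff_integrableOn_Ioc_of_le hq1).1 hint
  · exact ae_of_all _ fun s => (Real.exp_pos _).le

/-- Frullani's formula for `-log`. -/
lemma negLog_eq_lintegral {q : ℝ} (hq : 0 ≤ q) (hq1 : q ≤ 1) :
    negLog q = ∫⁻ t in Set.Ioi (0 : ℝ),
      ENNReal.ofReal ((Real.exp (-(t * q)) - Real.exp (-t)) / t) := by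
  -- The Frullani integrand is ∫_q^1 e^{−ts} ds; Tonelli then leaves ∫_q^1 ds/s.
  have h1 : ∫⁻ t in Set.Ioi (0 : ℝ), ENNReal.ofReal ((Real.exp (-(t * q)) - Real.exp (-t)) / t) =
      ∫⁻ t in Set.Ioi (0 : ℝ), ∫⁻ s in Set.Ioc q 1, ENNReal.ofReal (Real.exp (-(t * s))) :=
    setLIntegral_congr_fun measurableSet_Ioi fun t ht => (lintegral_exp_neg_mul_Ioc hq1 ht).symm
  have h2 : ∫⁻ s in Set.Ioc q 1, ∫⁻ t in Set.Ioi (0 : ℝ), ENNReal.ofReal (Real.exp (-(t * s))) =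
      ∫⁻ s in Set.Ioc q 1, ENNReal.ofReal s⁻¹ :=
    setLIntegral_congr_fun measurableSet_Ioc fun s hs =>
      lintegral_exp_neg_mul_Ioi (hq.trans_lt hs.1)
  rw [h1, lintegral_lintegral_swap, h2, lintegral_inv_Ioc_eq_negLog hq hq1]
  exact (by fun_prop : Measurable fun p : ℝ × ℝ =>
    ENNReal.ofReal (Real.exp (-(p.1 * p.2)))).aemeasurable

end NegLog

/-! ### Stereographic projection and convexity of the chordal logarithmic energy -/

section Sphere

open scoped RealInnerProductSpace

variable {E : Type*} [NormedAddCommGroup E] [InnerProductSpace ℝ E]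

/-- The squared chordal distance of the stereographic projections onto a sphere of diameter `1`. -/
def chordSq (x y : E) : ℝ := ‖x - y‖ ^ 2 / ((1 + ‖x‖ ^ 2) * (1 + ‖y‖ ^ 2))

/-- The inverse stereographic projection onto a sphere of diameter `1`. -/
def sphereMap (x : E) : WithLp 2 (E × ℝ) :=
  WithLp.toLp 2 ((1 + ‖x‖ ^ 2)⁻¹ • x, ‖x‖ ^ 2 / (1 + ‖x‖ ^ 2))

/-- Realizes the chordal distance as a Euclidean one, so that Gaussian positive definiteness applies
to it. -/
lemma norm_sphereMap_sub_sq (x y : E) : ‖sphereMap x - sphereMap y‖ ^ 2 = chordSq x y := by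
  rw [WithLp.prod_norm_sq_eq_of_L2]
  change ‖(1 + ‖x‖ ^ 2)⁻¹ • x - (1 + ‖y‖ ^ 2)⁻¹ • y‖ ^ 2 +
    ‖‖x‖ ^ 2 / (1 + ‖x‖ ^ 2) - ‖y‖ ^ 2 / (1 + ‖y‖ ^ 2)‖ ^ 2 = _
  unfold chordSq
  rw [Real.norm_eq_abs (_ - _), sq_abs, norm_sub_sq_real x y, norm_sub_sq_real, norm_smul, norm_smul, real_inner_smul_left,
    real_inner_smul_right, Real.norm_eq_abs, Real.norm_eq_abs,
    abs_of_pos (by positivity), abs_of_pos (by positivity)]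
  field_simp
  ring

lemma chordSq_nonneg (x y : E) : 0 ≤ chordSq x y := by unfold chordSq; positivity

/-- The gap (1+|x|²)(1+|y|²) − |x−y|² equals 1 + |x|²|y|² + 2⟨x,y⟩ ≥ (1 − |x||y|)² by
Cauchy–Schwarz. -/
lemma chordSq_le_one (x y : E) : chordSq x y ≤ 1 := by
  unfold chordSq
  rw [div_le_one (by positivity)]
  have h1 := norm_sub_sq_real x y
  have h2 := abs_real_inner_le_norm x y
  have h3 := abs_le.1 h2
  nlinarith [sq_nonneg (1 - ‖x‖ * ‖y‖), sq_nonneg (‖x‖ - ‖y‖)]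

/-- Two points far out are both projected near the pole, hence close to each other. -/
lemma chordSq_le_of_norm {R : ℝ} (hR : 0 ≤ R) {x y : E} (hx : R ≤ ‖x‖) (hy : R ≤ ‖y‖) :
    chordSq x y ≤ 4 / (1 + R ^ 2) := by
  unfold chordSq
  have h1 : ‖x - y‖ ^ 2 ≤ 2 * (‖x‖ ^ 2 + ‖y‖ ^ 2) := by
    have := norm_sub_le x y
    nlinarith [sq_nonneg (‖x‖ - ‖y‖), norm_nonneg (x - y)]
  have hx2 : R ^ 2 ≤ ‖x‖ ^ 2 := by gcongr
  have hy2 : R ^ 2 ≤ ‖y‖ ^ 2 := by gcongr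
  rw [div_le_div_iff₀ (by positivity) (by positivity)]
  set X := ‖x‖ ^ 2
  set Y := ‖y‖ ^ 2
  have hX : 0 ≤ X := by positivity
  have hY : 0 ≤ Y := by positivity
  calc ‖x - y‖ ^ 2 * (1 + R ^ 2) ≤ 2 * (X + Y) * (1 + R ^ 2) := by gcongr
    _ ≤ 2 * (X * (1 + Y) + Y * (1 + X)) := by nlinarith
    _ ≤ 4 * ((1 + X) * (1 + Y)) := by nlinarith [mul_nonneg hX hY]

lemma continuous_sphereMap : Continuous (sphereMap : E → WithLp 2 (E × ℝ)) := by
  unfold sphereMap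
  have h : ∀ x : E, 1 + ‖x‖ ^ 2 ≠ 0 := fun x => by positivity
  refine (WithLp.prod_continuous_toLp 2 E ℝ).comp ?_
  exact (Continuous.smul (Continuous.inv₀ (by fun_prop) h) continuous_id).prodMk
    (Continuous.div (by fun_prop) (by fun_prop) h)

lemma continuous_chordSq : Continuous fun z : E × E => chordSq z.1 z.2 := by
  unfold chordSq
  exact Continuous.div (by fun_prop) (by fun_prop) fun z => by positivity

variable [FiniteDimensional ℝ E] [MeasurableSpace E] [BorelSpace E]

lemma map_sphereMap_injective {μ ν : Measure E}
    (h : μ.map sphereMap = ν.map sphereMap) : μ = ν := by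
  have hm : Measurable (sphereMap : E → WithLp 2 (E × ℝ)) := continuous_sphereMap.measurable
  -- Stereographic projection from the pole, a measurable left inverse; its value at the pole
  -- itself, not in the image, is irrelevant.
  let S : WithLp 2 (E × ℝ) → E := fun p => (1 - p.snd)⁻¹ • p.fst
  have hS : Measurable S := by
    have h1 : Measurable fun p : WithLp 2 (E × ℝ) => p.fst :=
      (by fun_prop : Continuous fun p : WithLp 2 (E × ℝ) => p.fst).measurable
    have h2 : Measurable fun p : WithLp 2 (E × ℝ) => p.snd :=
      (by fun_prop : Continuous fun p : WithLp 2 (E × ℝ) => p.snd).measurable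
    exact (measurable_const.sub h2).inv.smul h1
  have hST : S ∘ sphereMap = id := by
    ext x
    have h0 : 1 + ‖x‖ ^ 2 ≠ 0 := by positivity
    change (1 - ‖x‖ ^ 2 / (1 + ‖x‖ ^ 2))⁻¹ • (1 + ‖x‖ ^ 2)⁻¹ • x = x
    rw [smul_smul]
    convert one_smul ℝ x using 2
    have : 1 - ‖x‖ ^ 2 / (1 + ‖x‖ ^ 2) = (1 + ‖x‖ ^ 2)⁻¹ := by field_simp; ring
    rw [this]
    field_simp
  have := congrArg (Measure.map S) h
  rwa [Measure.map_map hS hm, Measure.map_map hS hm, hST, Measure.map_id, Measure.map_id] at this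

/-- The mutual logarithmic energy for the chordal distance. -/
def chordEnergy (μ ν : Measure E) : ℝ≥0∞ := ∫⁻ z : E × E, negLog (chordSq z.1 z.2) ∂(μ.prod ν)

/-- Frullani's formula integrated against μ × ν; the constant e^{−t} passes through because the
total mass is 1. -/
lemma chordEnergy_eq_lintegral (μ ν : Measure E) [IsProbabilityMeasure μ]
    [IsProbabilityMeasure ν] :
    chordEnergy μ ν = ∫⁻ t in Set.Ioi (0 : ℝ), ENNReal.ofReal
      ((gaussianEnergy t (μ.map sphereMap) (ν.map sphereMap) - Real.exp (-t)) / t) := by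
  have hc := continuous_chordSq (E := E)
  have hm : Measurable (sphereMap : E → WithLp 2 (E × ℝ)) := continuous_sphereMap.measurable
  have h1 : chordEnergy μ ν = ∫⁻ z : E × E, (∫⁻ t in Set.Ioi (0 : ℝ),
      ENNReal.ofReal ((Real.exp (-(t * chordSq z.1 z.2)) - Real.exp (-t)) / t)) ∂(μ.prod ν) :=
    lintegral_congr fun z => negLog_eq_lintegral (chordSq_nonneg _ _) (chordSq_le_one _ _)
  rw [h1, lintegral_lintegral_swap]
  · refine setLIntegral_congr_fun measurableSet_Ioi fun t ht => ?_
    have ht : 0 < t := ht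
    have hint : Integrable (fun z : E × E => Real.exp (-(t * chordSq z.1 z.2))) (μ.prod ν) := by
      refine (integrable_const (1 : ℝ)).mono'
        (by fun_prop : Continuous fun z : E × E =>
          Real.exp (-(t * chordSq z.1 z.2))).aestronglyMeasurable (ae_of_all _ fun z => ?_)
      rw [Real.norm_eq_abs, Real.abs_exp]
      have := chordSq_nonneg z.1 z.2
      exact Real.exp_le_one_iff.2 (by nlinarith)
    have hint2 : Integrable (fun z : E × E =>
        (Real.exp (-(t * chordSq z.1 z.2)) - Real.exp (-t)) / t) (μ.prod ν) :=
      (hint.sub (integrable_const (Real.exp (-t)))).div_const t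
    rw [← ofReal_integral_eq_lintegral_ofReal hint2]
    · congr 1
      have hsub := integral_sub hint (integrable_const (Real.exp (-t)))
      rw [integral_div]
      congr 1
      refine hsub.trans ?_
      rw [integral_const, probReal_univ, one_smul]
      congr 1
      unfold gaussianEnergy
      rw [Measure.map_prod_map _ _ hm hm, integral_map (hm.prodMap hm).aemeasurable]
      · simp [norm_sphereMap_sub_sq]
      · exact (by fun_prop : Continuous fun z : WithLp 2 (E × ℝ) × WithLp 2 (E × ℝ) =>
          Real.exp (-(t * ‖z.1 - z.2‖ ^ 2))).aestronglyMeasurable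
    · refine ae_of_all _ fun z => div_nonneg (sub_nonneg.2 (Real.exp_le_exp.2 ?_)) ht.le
      nlinarith [chordSq_le_one z.1 z.2]
  · have hc' : Measurable fun z : E × E => chordSq z.1 z.2 := hc.measurable
    exact (by fun_prop : Measurable fun p : (E × E) × ℝ => ENNReal.ofReal
      ((Real.exp (-(p.2 * chordSq p.1.1 p.1.2)) - Real.exp (-p.2)) / p.2)).aemeasurable

lemma exp_neg_le_gaussianEnergy {t : ℝ} (ht : 0 < t) (μ ν : Measure E)
    [IsProbabilityMeasure μ] [IsProbabilityMeasure ν] :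
    Real.exp (-t) ≤ gaussianEnergy t (μ.map sphereMap) (ν.map sphereMap) := by
  have hc := continuous_chordSq (E := E)
  have hm : Measurable (sphereMap : E → WithLp 2 (E × ℝ)) := continuous_sphereMap.measurable
  unfold gaussianEnergy
  rw [Measure.map_prod_map _ _ hm hm, integral_map (hm.prodMap hm).aemeasurable
    (by fun_prop : Continuous fun z : WithLp 2 (E × ℝ) × WithLp 2 (E × ℝ) =>
      Real.exp (-(t * ‖z.1 - z.2‖ ^ 2))).aestronglyMeasurable]
  simp only [Prod.map_fst, Prod.map_snd, norm_sphereMap_sub_sq]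
  have hint : Integrable (fun z : E × E => Real.exp (-(t * chordSq z.1 z.2))) (μ.prod ν) := by
    refine (integrable_const (1 : ℝ)).mono'
      (by fun_prop : Continuous fun z : E × E =>
        Real.exp (-(t * chordSq z.1 z.2))).aestronglyMeasurable (ae_of_all _ fun z => ?_)
    rw [Real.norm_eq_abs, Real.abs_exp]
    have := chordSq_nonneg z.1 z.2
    exact Real.exp_le_one_iff.2 (by nlinarith)
  calc Real.exp (-t) = ∫ z : E × E, Real.exp (-t) ∂(μ.prod ν) := by simp
    _ ≤ _ := integral_mono (integrable_const _) hint fun z =>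
      Real.exp_le_exp.2 (by nlinarith [chordSq_le_one z.1 z.2])

lemma measurable_gaussianEnergy {H : Type*} [NormedAddCommGroup H] [InnerProductSpace ℝ H]
    [FiniteDimensional ℝ H] [MeasurableSpace H] [BorelSpace H] (μ ν : Measure H)
    [IsFiniteMeasure μ] [IsFiniteMeasure ν] : Measurable fun t => gaussianEnergy t μ ν := by
  unfold gaussianEnergy
  exact (StronglyMeasurable.integral_prod_right (ν := μ.prod ν)
    (f := fun (t : ℝ) (z : H × H) => Real.exp (-(t * ‖z.1 - z.2‖ ^ 2)))
    (by fun_prop : Continuous fun w : ℝ × (H × H) =>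
      Real.exp (-(w.1 * ‖w.2.1 - w.2.2‖ ^ 2))).stronglyMeasurable).measurable

/-- The Gaussian inequalities hold for each t > 0, the terms e^{−t} cancelling between the two
sides, and are integrated in t. Finiteness of both self-energies makes the smaller integral finite,
as strictness after integration requires. -/
lemma chordEnergy_convexity (μ ν : Measure E) [IsProbabilityMeasure μ] [IsProbabilityMeasure ν] :
    2 * chordEnergy μ ν ≤ chordEnergy μ μ + chordEnergy ν ν ∧
      (chordEnergy μ μ ≠ ⊤ → chordEnergy ν ν ≠ ⊤ → μ ≠ ν →
        2 * chordEnergy μ ν < chordEnergy μ μ + chordEnergy ν ν) := by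
  have hm : Measurable (sphereMap : E → WithLp 2 (E × ℝ)) := continuous_sphereMap.measurable
  have hp : ∀ (μ : Measure E) [IsProbabilityMeasure μ], IsProbabilityMeasure (μ.map sphereMap) :=
    fun μ _ => Measure.isProbabilityMeasure_map hm.aemeasurable
  have hpμ := hp μ
  have hpν := hp ν
  set f : Measure E → Measure E → ℝ → ℝ := fun μ ν t =>
    (gaussianEnergy t (μ.map sphereMap) (ν.map sphereMap) - Real.exp (-t)) / t with hf
  have hfm : ∀ (μ ν : Measure E) [IsProbabilityMeasure μ] [IsProbabilityMeasure ν],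
      Measurable fun t => ENNReal.ofReal (f μ ν t) := by
    intro μ ν _ _
    have := hp μ
    have := hp ν
    have := measurable_gaussianEnergy (μ.map sphereMap) (ν.map sphereMap)
    fun_prop
  have hf0 : ∀ (μ ν : Measure E) [IsProbabilityMeasure μ] [IsProbabilityMeasure ν], ∀ t,
      0 < t → 0 ≤ f μ ν t := fun μ ν _ _ t ht =>
    div_nonneg (sub_nonneg.2 (exp_neg_le_gaussianEnergy ht μ ν)) ht.le
  have hle : ∀ t ∈ Set.Ioi (0 : ℝ), 2 * ENNReal.ofReal (f μ ν t) ≤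
      ENNReal.ofReal (f μ μ t) + ENNReal.ofReal (f ν ν t) := by
    intro t ht
    rw [← ENNReal.ofReal_add (hf0 μ μ t ht) (hf0 ν ν t ht), ← ENNReal.ofReal_ofNat 2,
      ← ENNReal.ofReal_mul (by norm_num)]
    refine ENNReal.ofReal_le_ofReal ?_
    have h := two_mul_gaussianEnergy_le ht (μ.map sphereMap) (ν.map sphereMap)
    have ht : (0 : ℝ) < t := ht
    simp only [hf]
    rw [← add_div, ← mul_div_assoc]
    gcongr
    linarith
  have hlt : μ ≠ ν → ∀ t ∈ Set.Ioi (0 : ℝ), 2 * ENNReal.ofReal (f μ ν t) <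
      ENNReal.ofReal (f μ μ t) + ENNReal.ofReal (f ν ν t) := by
    intro hne t ht
    have ht : (0 : ℝ) < t := ht
    have hlt : 2 * f μ ν t < f μ μ t + f ν ν t := by
      have h := two_mul_gaussianEnergy_lt ht fun h => hne (map_sphereMap_injective h)
      simp only [hf]
      rw [← add_div, ← mul_div_assoc]
      gcongr
      linarith
    rw [← ENNReal.ofReal_add (hf0 μ μ t ht) (hf0 ν ν t ht), ← ENNReal.ofReal_ofNat 2,
      ← ENNReal.ofReal_mul (by norm_num)]
    refine (ENNReal.ofReal_lt_ofReal_iff ?_).2 hlt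
    linarith [hf0 μ ν t ht]
  have e : ∀ (μ ν : Measure E) [IsProbabilityMeasure μ] [IsProbabilityMeasure ν],
      chordEnergy μ ν = ∫⁻ t in Set.Ioi (0 : ℝ), ENNReal.ofReal (f μ ν t) :=
    fun μ ν _ _ => chordEnergy_eq_lintegral μ ν
  rw [e, e, e, ← lintegral_const_mul _ (hfm μ ν), ← lintegral_add_left (hfm μ μ)]
  refine ⟨setLIntegral_mono ((hfm μ μ).add (hfm ν ν)) hle, fun h1 h2 hne => ?_⟩
  refine setLIntegral_strict_mono measurableSet_Ioi (by simp) ((hfm μ μ).add (hfm ν ν)) ?_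
    (ae_of_all _ (hlt hne))
  refine ne_top_of_le_ne_top (b := ∫⁻ t in Set.Ioi (0 : ℝ), ENNReal.ofReal (f μ μ t) +
    ENNReal.ofReal (f ν ν t)) ?_ (setLIntegral_mono ((hfm μ μ).add (hfm ν ν)) hle)
  rw [lintegral_add_left (hfm μ μ)]
  exact ENNReal.add_ne_top.2 ⟨h1, h2⟩

end Sphere

/-! ### The pair factor exp(−F_V − C) -/

section Kernel

variable {E : Type*} [NormedAddCommGroup E]

/-- The potential dominates `(β / 2) log (1 + |x|²)` up to the constant `C`. -/
def LogConfining (β C : ℝ) (V : E → ℝ) : Prop :=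
  ∀ x, β / 2 * Real.log (1 + ‖x‖ ^ 2) - C ≤ V x

/-- The pair interaction factor `exp (- F_V (x, y) - C)`. -/
def pairWeight (β C : ℝ) (V : E → ℝ) (x y : E) : ℝ :=
  ‖x - y‖ ^ (β / 2) * Real.exp (-((V x + V y) / 2 + C))

/-- The one-particle part of the kernel `F_V + C` in terms of the chordal distance. -/
def residualPotential (β C : ℝ) (V : E → ℝ) (x : E) : ℝ :=
  V x / 2 - β / 4 * Real.log (1 + ‖x‖ ^ 2) + C / 2

variable {β C : ℝ} {V : E → ℝ}

lemma residualPotential_nonneg (hC : LogConfining β C V) (x : E) :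
    0 ≤ residualPotential β C V x := by
  have := hC x
  unfold residualPotential
  linarith

lemma pairWeight_nonneg (x y : E) : 0 ≤ pairWeight β C V x y := by
  unfold pairWeight; positivity

lemma pairWeight_comm (x y : E) : pairWeight β C V x y = pairWeight β C V y x := by
  unfold pairWeight
  rw [norm_sub_rev, add_comm (V x)]

lemma pairWeight_pos {x y : E} (h : x ≠ y) : 0 < pairWeight β C V x y := by
  have : 0 < ‖x - y‖ := norm_pos_iff.2 (sub_ne_zero.2 h)
  unfold pairWeight; positivity

lemma pairWeight_self (hβ : 0 < β) (x : E) : pairWeight β C V x x = 0 := by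
  simp [pairWeight, Real.zero_rpow (by positivity : β / 2 ≠ 0)]

/-- The factors (1+|x|²)^{β/4}(1+|y|²)^{β/4} that turn |x−y|^{β/2} into a power of the chordal
distance are moved into the one-particle terms. -/
lemma pairWeight_eq (x y : E) : pairWeight β C V x y =
    Real.exp (-residualPotential β C V x) *
      (Real.exp (-residualPotential β C V y) * chordSq x y ^ (β / 4)) := by
  have hx : 0 < 1 + ‖x‖ ^ 2 := by positivity
  have hy : 0 < 1 + ‖y‖ ^ 2 := by positivity
  unfold pairWeight chordSq residualPotential
  rw [Real.div_rpow (by positivity) (by positivity), Real.mul_rpow hx.le hy.le,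
    ← Real.rpow_natCast ‖x - y‖, ← Real.rpow_mul (norm_nonneg (x - y)),
    Real.rpow_def_of_pos hx (β / 4), Real.rpow_def_of_pos hy (β / 4)]
  have h1 : ((2 : ℕ) : ℝ) * (β / 4) = β / 2 := by push_cast; ring
  rw [h1, ← Real.exp_add, div_eq_mul_inv (‖x - y‖ ^ (β / 2)), ← Real.exp_neg, mul_left_comm _ (‖x - y‖ ^ (β / 2)),
    mul_left_comm _ (‖x - y‖ ^ (β / 2)), ← Real.exp_add, ← Real.exp_add]
  congr 2
  ring

lemma pairWeight_le_rpow (hC : LogConfining β C V) (x y : E) :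
    pairWeight β C V x y ≤ chordSq x y ^ (β / 4) := by
  have h0 : 0 ≤ chordSq x y := by unfold chordSq; positivity
  rw [pairWeight_eq, ← mul_assoc]
  refine mul_le_of_le_one_left (Real.rpow_nonneg h0 _) (mul_le_one₀ ?_ (Real.exp_pos _).le ?_) <;>
  simp [residualPotential_nonneg hC]

lemma continuous_pairWeight (hβ : 0 < β) (hV : Continuous V) :
    Continuous fun z : E × E => pairWeight β C V z.1 z.2 := by
  unfold pairWeight
  refine Continuous.mul ?_ (by fun_prop)
  exact Continuous.rpow_const (by fun_prop) fun z => Or.inr (by positivity)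

end Kernel

/-! ### Convexity of the weighted energy and uniqueness of the minimizer -/

section Energy

variable {E : Type*} [NormedAddCommGroup E] [InnerProductSpace ℝ E]
  {β C : ℝ} {V : E → ℝ}

lemma pairWeight_le_one (hβ : 0 < β) (hC : LogConfining β C V) (x y : E) :
    pairWeight β C V x y ≤ 1 :=
  (pairWeight_le_rpow hC x y).trans
    (Real.rpow_le_one (chordSq_nonneg x y) (chordSq_le_one x y) (by positivity))

lemma negLog_pairWeight (hβ : 0 < β) (hC : LogConfining β C V) (x y : E) :
    negLog (pairWeight β C V x y) = ENNReal.ofReal (residualPotential β C V x) +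
      (ENNReal.ofReal (residualPotential β C V y) +
        ENNReal.ofReal (β / 4) * negLog (chordSq x y)) := by
  have h0 := chordSq_nonneg x y
  have h1 := chordSq_le_one x y
  have h2 : chordSq x y ^ (β / 4) ≤ 1 := Real.rpow_le_one h0 h1 (by positivity)
  have h3 : ∀ x, Real.exp (-residualPotential β C V x) ≤ 1 := fun x => by
    simp [residualPotential_nonneg hC]
  rw [pairWeight_eq, negLog_mul (Real.exp_pos _).le (h3 x) (by positivity)
    (mul_le_one₀ (h3 y) (by positivity) h2), negLog_mul (Real.exp_pos _).le (h3 y) (by positivity)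
    h2, negLog_exp_neg, negLog_exp_neg, negLog_rpow h0 (by positivity)]

variable [FiniteDimensional ℝ E] [MeasurableSpace E] [BorelSpace E]

/-- The mutual energy of two measures for the kernel `F_V + C`. -/
def mutualEnergy (β C : ℝ) (V : E → ℝ) (μ ν : Measure E) : ℝ≥0∞ :=
  ∫⁻ z : E × E, negLog (pairWeight β C V z.1 z.2) ∂(μ.prod ν)

lemma measurable_negLog_pairWeight (hβ : 0 < β) (hV : Continuous V) :
    Measurable fun z : E × E => negLog (pairWeight β C V z.1 z.2) :=
  measurable_negLog.comp (continuous_pairWeight hβ hV).measurable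

lemma mutualEnergy_comm (μ ν : Measure E) [SFinite μ]
    [SFinite ν] : mutualEnergy β C V μ ν = mutualEnergy β C V ν μ := by
  unfold mutualEnergy
  rw [← lintegral_prod_swap]
  simp [pairWeight_comm]

lemma measurable_residualPotential (hV : Continuous V) :
    Measurable (residualPotential β C V) := by
  have := hV.measurable
  unfold residualPotential
  fun_prop

/-- Only the chordal term is quadratic in the measures; the potential terms are linear and drop out
of the convexity comparison. -/
lemma mutualEnergy_eq (hβ : 0 < β) (hV : Continuous V) (hC : LogConfining β C V)
    (μ ν : Measure E) [IsProbabilityMeasure μ] [IsProbabilityMeasure ν] :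
    mutualEnergy β C V μ ν = ∫⁻ x, ENNReal.ofReal (residualPotential β C V x) ∂μ +
      (∫⁻ x, ENNReal.ofReal (residualPotential β C V x) ∂ν +
        ENNReal.ofReal (β / 4) * chordEnergy μ ν) := by
  have hr := measurable_residualPotential (β := β) (C := C) hV
  have hq : Measurable fun z : E × E => negLog (chordSq z.1 z.2) :=
    measurable_negLog.comp continuous_chordSq.measurable
  unfold mutualEnergy chordEnergy
  simp_rw [negLog_pairWeight hβ hC]
  rw [lintegral_add_left (by fun_prop), lintegral_add_left (by fun_prop),
    lintegral_const_mul _ hq]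
  congr 1
  · rw [lintegral_prod _ (by fun_prop)]
    simp
  · congr 1
    rw [lintegral_prod _ (by fun_prop)]
    simp

lemma two_mul_mutualEnergy_le (hβ : 0 < β) (hV : Continuous V) (hC : LogConfining β C V)
    (μ ν : Measure E) [IsProbabilityMeasure μ] [IsProbabilityMeasure ν] :
    2 * mutualEnergy β C V μ ν ≤ mutualEnergy β C V μ μ + mutualEnergy β C V ν ν := by
  rw [mutualEnergy_eq hβ hV hC, mutualEnergy_eq hβ hV hC, mutualEnergy_eq hβ hV hC]
  set A := ∫⁻ x, ENNReal.ofReal (residualPotential β C V x) ∂μ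
  set B := ∫⁻ x, ENNReal.ofReal (residualPotential β C V x) ∂ν
  calc 2 * (A + (B + ENNReal.ofReal (β / 4) * chordEnergy μ ν))
      = (A + A) + (B + B) + ENNReal.ofReal (β / 4) * (2 * chordEnergy μ ν) := by ring
    _ ≤ (A + A) + (B + B) +
        ENNReal.ofReal (β / 4) * (chordEnergy μ μ + chordEnergy ν ν) := by
      gcongr
      exact (chordEnergy_convexity μ ν).1
    _ = _ := by ring

lemma two_mul_mutualEnergy_lt (hβ : 0 < β) (hV : Continuous V) (hC : LogConfining β C V)
    {μ ν : Measure E} [IsProbabilityMeasure μ] [IsProbabilityMeasure ν]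
    (hμ : mutualEnergy β C V μ μ ≠ ⊤) (hν : mutualEnergy β C V ν ν ≠ ⊤) (hne : μ ≠ ν) :
    2 * mutualEnergy β C V μ ν < mutualEnergy β C V μ μ + mutualEnergy β C V ν ν := by
  rw [mutualEnergy_eq hβ hV hC] at hμ hν
  rw [mutualEnergy_eq hβ hV hC, mutualEnergy_eq hβ hV hC, mutualEnergy_eq hβ hV hC]
  set A := ∫⁻ x, ENNReal.ofReal (residualPotential β C V x) ∂μ
  set B := ∫⁻ x, ENNReal.ofReal (residualPotential β C V x) ∂ν
  have hb : ENNReal.ofReal (β / 4) ≠ 0 := by simpa using hβ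
  have hA : A ≠ ⊤ := fun h => hμ (by simp [h])
  have hB : B ≠ ⊤ := fun h => hν (by simp [h])
  have hμ' : chordEnergy μ μ ≠ ⊤ := fun h => hμ (by simp [h, ENNReal.mul_top hb])
  have hν' : chordEnergy ν ν ≠ ⊤ := fun h => hν (by simp [h, ENNReal.mul_top hb])
  calc 2 * (A + (B + ENNReal.ofReal (β / 4) * chordEnergy μ ν))
      = (A + A) + (B + B) + ENNReal.ofReal (β / 4) * (2 * chordEnergy μ ν) := by ring
    _ < (A + A) + (B + B) +
        ENNReal.ofReal (β / 4) * (chordEnergy μ μ + chordEnergy ν ν) := by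
      refine ENNReal.add_lt_add_left (by simp [hA, hB]) ?_
      exact ENNReal.mul_lt_mul_right hb ENNReal.ofReal_ne_top
        ((chordEnergy_convexity μ ν).2 hμ' hν' hne)
    _ = _ := by ring

/-- The midpoint of two probability measures. -/
def midpointMeasure (μ ν : Measure E) : Measure E := (2⁻¹ : ℝ≥0∞) • (μ + ν)

instance (μ ν : Measure E) [IsProbabilityMeasure μ] [IsProbabilityMeasure ν] :
    IsProbabilityMeasure (midpointMeasure μ ν) :=
  ⟨by simp [midpointMeasure, ENNReal.inv_two_add_inv_two]⟩

lemma four_mul_mutualEnergy_midpoint (μ ν : Measure E) [IsProbabilityMeasure μ] [IsProbabilityMeasure ν] :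
    4 * mutualEnergy β C V (midpointMeasure μ ν) (midpointMeasure μ ν) =
      mutualEnergy β C V μ μ + mutualEnergy β C V ν ν + 2 * mutualEnergy β C V μ ν := by
  have hc := mutualEnergy_comm (β := β) (C := C) (V := V) ν μ
  unfold mutualEnergy at *
  unfold midpointMeasure
  have h2 : SFinite ((2⁻¹ : ℝ≥0∞) • (μ + ν)) := inferInstance
  rw [Measure.prod_smul_left, Measure.prod_smul_right, Measure.prod_add, Measure.add_prod,
    Measure.add_prod, smul_smul]
  simp only [lintegral_smul_measure, lintegral_add_measure, smul_eq_mul]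
  rw [hc, ← mul_assoc]
  have : (4 : ℝ≥0∞) * (2⁻¹ * 2⁻¹) = 1 := by
    rw [← ENNReal.mul_inv (by simp) (by simp)]
    norm_num
    exact ENNReal.mul_inv_cancel (by simp) (by simp)
  rw [this, one_mul]
  ring

/-- A minimizer of the energy with finite energy is unique. -/
lemma minimizer_unique (hβ : 0 < β) (hV : Continuous V) (hC : LogConfining β C V)
    {μ ν : Measure E} [IsProbabilityMeasure μ] [IsProbabilityMeasure ν] {m : ℝ≥0∞} (hm : m ≠ ⊤)
    (hmin : ∀ η : ProbabilityMeasure E, m ≤ mutualEnergy β C V η η)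
    (hμ : mutualEnergy β C V μ μ ≤ m) (hν : mutualEnergy β C V ν ν ≤ m) : μ = ν := by
  by_contra hne
  have h1 := two_mul_mutualEnergy_lt hβ hV hC (ne_top_of_le_ne_top hm hμ)
    (ne_top_of_le_ne_top hm hν) hne
  have h2 := hmin ⟨midpointMeasure μ ν, inferInstance⟩
  have h3 := four_mul_mutualEnergy_midpoint (β := β) (C := C) (V := V) μ ν
  have h4 : 4 * m < 4 * m := calc
    4 * m ≤ 4 * mutualEnergy β C V (midpointMeasure μ ν) (midpointMeasure μ ν) := by
        gcongr; exact h2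
    _ = mutualEnergy β C V μ μ + mutualEnergy β C V ν ν + 2 * mutualEnergy β C V μ ν := h3
    _ < mutualEnergy β C V μ μ + mutualEnergy β C V ν ν +
        (mutualEnergy β C V μ μ + mutualEnergy β C V ν ν) :=
      ENNReal.add_lt_add_left (ENNReal.add_ne_top.2 ⟨ne_top_of_le_ne_top hm hμ,
        ne_top_of_le_ne_top hm hν⟩) h1
    _ ≤ m + m + (m + m) := by gcongr
    _ = 4 * m := by ring
  exact lt_irrefl _ h4

end Energy

/-! ### Truncated energies, tightness and convergence to the minimizer -/

section Compactness

variable {E : Type*} [NormedAddCommGroup E] [InnerProductSpace ℝ E]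
  {β C : ℝ} {V : E → ℝ} [FiniteDimensional ℝ E] [MeasurableSpace E] [BorelSpace E]

/-- The energy for the kernel `F_V + C` truncated at height `M`. -/
def truncEnergy (β C : ℝ) (V : E → ℝ) (M : ℕ) (μ : Measure E) : ℝ≥0∞ :=
  ∫⁻ z : E × E, min (negLog (pairWeight β C V z.1 z.2)) M ∂(μ.prod μ)

lemma truncEnergy_le (M : ℕ) (μ : Measure E) :
    truncEnergy β C V M μ ≤ mutualEnergy β C V μ μ :=
  lintegral_mono fun _ => min_le_left _ _

lemma iSup_truncEnergy (hβ : 0 < β) (hV : Continuous V) (μ : Measure E) :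
    ⨆ M, truncEnergy β C V M μ = mutualEnergy β C V μ μ := by
  unfold truncEnergy mutualEnergy
  rw [← lintegral_iSup]
  · congr 1 with z
    rw [← inf_iSup_eq]
    simp [ENNReal.iSup_natCast]
  · intro M
    exact (measurable_negLog_pairWeight hβ hV).min measurable_const
  · intro M N hMN z
    dsimp only
    gcongr

/-- min(−log w, M) = −log max(w, e^{−M}) is bounded and continuous, also on the diagonal where w =
0, and taking product measures is weakly continuous. -/
lemma tendsto_truncEnergy (hβ : 0 < β) (hV : Continuous V) (M : ℕ)
    {ι : Type*} {l : Filter ι} {u : ι → ProbabilityMeasure E} {μ : ProbabilityMeasure E}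
    (hu : Tendsto u l (𝓝 μ)) :
    Tendsto (fun i => truncEnergy β C V M (u i)) l (𝓝 (truncEnergy β C V M μ)) := by
  have hprod : Tendsto (fun i => (u i).prod (u i)) l (𝓝 (μ.prod μ)) :=
    (ProbabilityMeasure.continuous_prod.tendsto (μ, μ)).comp (hu.prodMk_nhds hu)
  have hφ := continuous_pairWeight (C := C) hβ hV
  have hpos : ∀ z : E × E, 0 < max (pairWeight β C V z.1 z.2) (Real.exp (-M)) := fun z =>
    lt_max_of_lt_right (Real.exp_pos _)
  have hmin : ∀ z : E × E, min (negLog (pairWeight β C V z.1 z.2)) M =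
      ENNReal.ofReal (-Real.log (max (pairWeight β C V z.1 z.2) (Real.exp (-M)))) := by
    intro z
    rw [← negLog_of_pos (hpos z), negLog_antitone.map_max, negLog_exp_neg]
    simp
  let f : BoundedContinuousFunction (E × E) NNReal :=
    BoundedContinuousFunction.mkOfBound ⟨fun z => Real.toNNReal
      (-Real.log (max (pairWeight β C V z.1 z.2) (Real.exp (-M)))), by
        refine continuous_real_toNNReal.comp (Continuous.neg (Continuous.log ?_ ?_))
        · fun_prop
        · exact fun z => (hpos z).ne'⟩ M (by
        intro x y
        have hb : ∀ z : E × E, Real.toNNReal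
            (-Real.log (max (pairWeight β C V z.1 z.2) (Real.exp (-M)))) ≤ M := by
          intro z
          rw [← ENNReal.coe_le_coe]
          have := (hmin z).symm.trans_le (min_le_right _ _)
          simpa [ENNReal.ofReal] using this
        rw [NNReal.dist_eq]
        have hx := NNReal.coe_le_coe.2 (hb x)
        have hy := NNReal.coe_le_coe.2 (hb y)
        have hx0 := NNReal.coe_nonneg (Real.toNNReal
            (-Real.log (max (pairWeight β C V x.1 x.2) (Real.exp (-M)))))
        have hy0 := NNReal.coe_nonneg (Real.toNNReal
            (-Real.log (max (pairWeight β C V y.1 y.2) (Real.exp (-M)))))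
        simp only [ContinuousMap.coe_mk, NNReal.coe_natCast] at *
        rw [abs_le]
        constructor <;> linarith)
  have h := (ProbabilityMeasure.tendsto_iff_forall_lintegral_tendsto.1 hprod) f
  unfold truncEnergy
  simp_rw [hmin]
  exact h

/-- Lower semicontinuity: the energy is a supremum of the weakly continuous truncated energies. -/
lemma mutualEnergy_le_of_tendsto (hβ : 0 < β) (hV : Continuous V)
    {u : ℕ → ProbabilityMeasure E} {μ : ProbabilityMeasure E} {a : ℝ≥0∞}
    (h : ∀ M : ℕ, ∀ b, a < b → ∀ᶠ n in atTop, truncEnergy β C V M (u n) ≤ b)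
    (hu : Tendsto u atTop (𝓝 μ)) : mutualEnergy β C V μ μ ≤ a := by
  rw [← iSup_truncEnergy hβ hV]
  refine iSup_le fun M => le_of_forall_gt_imp_ge_of_dense fun b hb => ?_
  exact le_of_tendsto (tendsto_truncEnergy hβ hV M hu) (h M b hb)

lemma exists_le_negLog_pairWeight (hβ : 0 < β) (hC : LogConfining β C V) (M : ℕ) :
    ∃ R : ℝ, 0 ≤ R ∧ ∀ x y : E, R ≤ ‖x‖ → R ≤ ‖y‖ →
      (M : ℝ≥0∞) ≤ negLog (pairWeight β C V x y) := by
  have hlim : Tendsto (fun R : ℝ => (4 / (1 + R ^ 2)) ^ (β / 4)) atTop (𝓝 0) := by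
    have h1 : Tendsto (fun R : ℝ => 4 / (1 + R ^ 2)) atTop (𝓝 0) :=
      Tendsto.const_div_atTop (tendsto_atTop_add_const_left _ _ (tendsto_pow_atTop (by norm_num))) _
    have h2 := h1.rpow_const (p := β / 4) (Or.inr (by positivity))
    rwa [Real.zero_rpow (by positivity)] at h2
  obtain ⟨R, hR, hR0⟩ := ((hlim.eventually_le_const (Real.exp_pos (-(M : ℝ)))).and
    (eventually_ge_atTop 0)).exists
  refine ⟨R, hR0, fun x y hx hy => ?_⟩
  have h3 : pairWeight β C V x y ≤ Real.exp (-(M : ℝ)) :=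
    (pairWeight_le_rpow hC x y).trans ((Real.rpow_le_rpow (chordSq_nonneg x y)
      (chordSq_le_of_norm hR0 hx hy) (by positivity)).trans hR)
  have h4 := negLog_antitone h3
  rw [negLog_exp_neg] at h4
  simpa using h4

/-- The kernel is known to be large only when both points are far, so the mass of the exterior S of
a ball is controlled through S × S: M μ(S)² is at most the truncated energy. -/
lemma isTightMeasureSet_of_truncEnergy (hβ : 0 < β)
    (hC : LogConfining β C V) {u : ℕ → ProbabilityMeasure E} {a : ℝ≥0∞} (ha : a ≠ ⊤)
    (h : ∀ M : ℕ, ∀ b, a < b → ∀ᶠ n in atTop, truncEnergy β C V M (u n) ≤ b) :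
    IsTightMeasureSet (Set.range fun n => (u n : Measure E)) := by
  refine isTightMeasureSet_range_of_tendsto_limsup_measure_norm_gt ?_
  rw [ENNReal.tendsto_nhds_zero]
  intro ε hε
  wlog hε1 : ε ≠ ⊤ generalizing ε
  · filter_upwards [this 1 one_pos ENNReal.one_ne_top] with r hr
    rw [not_not] at hε1
    rw [hε1]
    exact le_top
  have hab : a < a + 1 := ENNReal.lt_add_right ha one_ne_zero
  -- With Mε² > a + 1, mass above ε outside the ball would contradict the energy bound.
  obtain ⟨M, hM⟩ := ENNReal.exists_nat_mul_gt (a := ε * ε) (b := a + 1)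
    (mul_ne_zero hε.ne' hε.ne') (ENNReal.add_ne_top.2 ⟨ha, ENNReal.one_ne_top⟩)
  obtain ⟨R, hR0, hR⟩ := exists_le_negLog_pairWeight hβ hC M
  filter_upwards [eventually_ge_atTop R] with r hr
  refine limsup_le_of_le (by isBoundedDefault) ?_
  filter_upwards [h M (a + 1) hab] with n hn
  by_contra! hlt
  set S : Set E := {x | r < ‖x‖}
  have hS : MeasurableSet S := measurableSet_lt measurable_const measurable_norm
  have h1 : (M : ℝ≥0∞) * ((u n : Measure E) S * (u n : Measure E) S) ≤
      truncEnergy β C V M (u n) := by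
    rw [← Measure.prod_prod]
    calc (M : ℝ≥0∞) * ((u n : Measure E).prod (u n : Measure E)) (S ×ˢ S)
        = ∫⁻ z in S ×ˢ S, (M : ℝ≥0∞) ∂((u n : Measure E).prod (u n : Measure E)) := by simp
      _ ≤ ∫⁻ z in S ×ˢ S, min (negLog (pairWeight β C V z.1 z.2)) M
          ∂((u n : Measure E).prod (u n : Measure E)) := by
        refine setLIntegral_mono' (hS.prod hS) fun z hz => le_min ?_ le_rfl
        exact hR _ _ (hr.trans (le_of_lt hz.1)) (hr.trans (le_of_lt hz.2))
      _ ≤ _ := setLIntegral_le_lintegral _ _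
  have h2 : (M : ℝ≥0∞) * (ε * ε) ≤ M * ((u n : Measure E) S * (u n : Measure E) S) := by
    gcongr
  exact absurd (hM.trans_le (h2.trans (h1.trans hn))) (lt_irrefl _)

/-- Measures of asymptotically bounded truncated energy have a subsequence converging to a measure
of bounded energy. -/
lemma exists_subseq_tendsto_mutualEnergy_le (hβ : 0 < β) (hV : Continuous V)
    (hC : LogConfining β C V) {u : ℕ → ProbabilityMeasure E} {a : ℝ≥0∞} (ha : a ≠ ⊤)
    (h : ∀ M : ℕ, ∀ b, a < b → ∀ᶠ n in atTop, truncEnergy β C V M (u n) ≤ b) :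
    ∃ (μ : ProbabilityMeasure E) (φ : ℕ → ℕ), StrictMono φ ∧ Tendsto (u ∘ φ) atTop (𝓝 μ) ∧
      mutualEnergy β C V μ μ ≤ a := by
  have ht := isTightMeasureSet_of_truncEnergy hβ hC ha h
  have hcomp : IsCompact (closure (Set.range u)) := by
    refine isCompact_closure_of_isTightMeasureSet ?_
    convert! ht using 1
    ext m
    simp
  obtain ⟨μ, -, φ, hφ, hlim⟩ := hcomp.tendsto_subseq (x := u)
    fun n => subset_closure (Set.mem_range_self n)
  exact ⟨μ, φ, hφ, hlim, mutualEnergy_le_of_tendsto hβ hV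
    (fun M b hb => hφ.tendsto_atTop.eventually (h M b hb)) hlim⟩

lemma exists_minimizer (hβ : 0 < β) (hV : Continuous V) (hC : LogConfining β C V)
    (hfin : ∃ η : ProbabilityMeasure E, mutualEnergy β C V η η ≠ ⊤) :
    ∃ μ : ProbabilityMeasure E, mutualEnergy β C V μ μ ≠ ⊤ ∧
      ∀ η : ProbabilityMeasure E, mutualEnergy β C V μ μ ≤ mutualEnergy β C V η η := by
  obtain ⟨η, hη⟩ := hfin
  set m : ℝ≥0∞ := ⨅ η : ProbabilityMeasure E, mutualEnergy β C V η η
  have hm : m ≠ ⊤ := ne_top_of_le_ne_top hη (iInf_le _ η)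
  have hu : ∀ n : ℕ, ∃ μ : ProbabilityMeasure E,
      mutualEnergy β C V μ μ < m + ((n : ℝ≥0∞) + 1)⁻¹ := by
    intro n
    refine iInf_lt_iff.1 (ENNReal.lt_add_right hm ?_)
    simp
  choose u hu using hu
  have hlim : Tendsto (fun n : ℕ => m + ((n : ℝ≥0∞) + 1)⁻¹) atTop (𝓝 m) := by
    have h1 : Tendsto (fun n : ℕ => ((n : ℝ≥0∞) + 1)⁻¹) atTop (𝓝 0) := by
      have := (tendsto_add_atTop_iff_nat 1).2 ENNReal.tendsto_inv_nat_nhds_zero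
      simpa using this
    simpa using tendsto_const_nhds.add h1
  obtain ⟨μ, -, -, -, hμ⟩ := exists_subseq_tendsto_mutualEnergy_le hβ hV hC (u := u) hm
    fun M b hb => (hlim.eventually_le_const hb).mono fun n hn =>
      ((truncEnergy_le M _).trans (hu n).le).trans hn
  exact ⟨μ, ne_top_of_le_ne_top hm hμ, fun η => hμ.trans (iInf_le _ η)⟩

/-- A sequence whose truncated energies are asymptotically minimal converges to the minimizer. -/
lemma tendsto_minimizer (hβ : 0 < β) (hV : Continuous V) (hC : LogConfining β C V)
    {μ : ProbabilityMeasure E} (hμ : mutualEnergy β C V μ μ ≠ ⊤)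
    (hmin : ∀ η : ProbabilityMeasure E, mutualEnergy β C V μ μ ≤ mutualEnergy β C V η η)
    {u : ℕ → ProbabilityMeasure E}
    (h : ∀ M : ℕ, ∀ b, mutualEnergy β C V μ μ < b →
      ∀ᶠ n in atTop, truncEnergy β C V M (u n) ≤ b) :
    Tendsto u atTop (𝓝 μ) := by
  refine tendsto_of_subseq_tendsto fun ns hns => ?_
  obtain ⟨ν, φ, hφ, hlim, hν⟩ := exists_subseq_tendsto_mutualEnergy_le hβ hV hC (u := u ∘ ns) hμ
    fun M b hb => hns.eventually (h M b hb)
  have : ν = μ := Subtype.ext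
    (minimizer_unique (μ := (ν : Measure E)) (ν := (μ : Measure E)) hβ hV hC hμ hmin hν le_rfl)
  exact ⟨φ, this ▸ hlim⟩

end Compactness

/-! ### A measure of finite energy -/

section FiniteEnergy

lemma lintegral_negLog_abs_Icc : ∫⁻ u in Set.Icc (-1 : ℝ) 1, negLog |u| < ⊤ := by
  have h1 : ∫⁻ u in Set.Icc (-1 : ℝ) 1, negLog |u| ≤
      ∫⁻ u in Set.Icc (-1 : ℝ) 1, ‖Real.log u‖ₑ := by
    refine lintegral_mono_ae ?_
    have h0 : ∀ᵐ u : ℝ, u ≠ 0 := by simp [ae_iff]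
    filter_upwards [ae_restrict_of_ae h0] with u hu
    rw [negLog_of_pos (abs_pos.2 hu), Real.log_abs, ← enorm_neg]
    exact Real.ofReal_le_enorm _
  refine h1.trans_lt ?_
  have h2 : IntegrableOn Real.log (Set.Icc (-1) 1) := by
    rw [integrableOn_Icc_iff_integrableOn_Ioc]
    exact (intervalIntegrable_iff_integrableOn_Ioc_of_le (by norm_num)).1
      intervalIntegral.intervalIntegrable_log'
  exact h2.2

variable {E : Type*} [NormedAddCommGroup E] [InnerProductSpace ℝ E]
  {β C : ℝ} {V : E → ℝ} [FiniteDimensional ℝ E] [MeasurableSpace E] [BorelSpace E]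

/-- The witness is the uniform measure on a unit segment: log is locally integrable in dimension
one, and V is bounded on the segment. -/
lemma exists_mutualEnergy_ne_top [Nontrivial E] (hβ : 0 < β) (hV : Continuous V) :
    ∃ η : ProbabilityMeasure E, mutualEnergy β C V η η ≠ ⊤ := by
  obtain ⟨e, he⟩ := exists_norm_eq E (zero_le_one' ℝ)
  have hg : Continuous fun s : ℝ => s • e := by fun_prop
  set ρ : Measure ℝ := volume.restrict (Set.Icc 0 1)
  have hρ : IsProbabilityMeasure ρ := ⟨by simp [ρ]⟩
  refine ⟨⟨ρ.map fun s => s • e, Measure.isProbabilityMeasure_map hg.aemeasurable⟩, ?_⟩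
  change mutualEnergy β C V (ρ.map fun s => s • e) (ρ.map fun s => s • e) ≠ ⊤
  obtain ⟨B, hB⟩ := (isCompact_Icc (a := (0 : ℝ)) (b := 1)).bddAbove_image
    (f := fun s : ℝ => V (s • e)) (by fun_prop)
  set K : ℝ := max (B + C) 0
  set k : ℝ → ℝ → ℝ≥0∞ := fun s s' => negLog (pairWeight β C V (s • e) (s' • e))
  have hk : ∀ s ∈ Set.Icc (0 : ℝ) 1, ∀ s' ∈ Set.Icc (0 : ℝ) 1,
      k s s' ≤ ENNReal.ofReal (β / 2) * negLog |s - s'| + ENNReal.ofReal K := by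
    intro s hs s' hs'
    have h1 : |s - s'| ≤ 1 := by
      rw [abs_le]
      constructor <;> linarith [hs.1, hs.2, hs'.1, hs'.2]
    have h2 : V (s • e) ≤ B := hB (Set.mem_image_of_mem _ hs)
    have h3 : V (s' • e) ≤ B := hB (Set.mem_image_of_mem _ hs')
    rw [← negLog_rpow (abs_nonneg _) (by positivity), ← negLog_exp_neg, ← negLog_mul
      (by positivity) (Real.rpow_le_one (abs_nonneg _) h1 (by positivity)) (Real.exp_pos _).le
      (Real.exp_le_one_iff.2 (by simp [K]))]
    refine negLog_antitone ?_
    unfold pairWeight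
    rw [← sub_smul, norm_smul, he, mul_one, Real.norm_eq_abs]
    gcongr
    linarith [le_max_left (B + C) 0]
  have hkm : Measurable (Function.uncurry k) :=
    (measurable_negLog_pairWeight hβ hV).comp
      ((hg.comp continuous_fst).prodMk (hg.comp continuous_snd)).measurable
  have h1 : mutualEnergy β C V (ρ.map fun s => s • e) (ρ.map fun s => s • e) =
      ∫⁻ s, ∫⁻ s', k s s' ∂ρ ∂ρ := by
    unfold mutualEnergy
    rw [Measure.map_prod_map _ _ hg.measurable hg.measurable,
      lintegral_map (measurable_negLog_pairWeight hβ hV) (hg.measurable.prodMap hg.measurable)]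
    exact lintegral_prod _ hkm.aemeasurable
  set L := ∫⁻ u in Set.Icc (-1 : ℝ) 1, negLog |u|
  have hinner : ∀ s ∈ Set.Icc (0 : ℝ) 1, ∫⁻ s', k s s' ∂ρ ≤
      ENNReal.ofReal (β / 2) * L + ENNReal.ofReal K := by
    intro s hs
    have hm : Measurable fun s' => negLog |s - s'| := by fun_prop
    calc ∫⁻ s', k s s' ∂ρ
        ≤ ∫⁻ s', ENNReal.ofReal (β / 2) * negLog |s - s'| + ENNReal.ofReal K ∂ρ :=
          setLIntegral_mono (by fun_prop) fun s' hs' => hk s hs s' hs'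
      _ = ENNReal.ofReal (β / 2) * ∫⁻ s', negLog |s - s'| ∂ρ + ENNReal.ofReal K := by
          rw [lintegral_add_right _ measurable_const, lintegral_const_mul _ hm]
          simp
      _ ≤ _ := by
          gcongr
          have h2 : L = ∫⁻ u, (Set.Icc (-1 : ℝ) 1).indicator (fun u => negLog |u|) u :=
            (lintegral_indicator measurableSet_Icc _).symm
          rw [h2, ← lintegral_sub_left_eq_self (μ := volume) _ s, ← lintegral_indicator measurableSet_Icc]
          refine lintegral_mono fun s' => ?_
          by_cases hs' : s' ∈ Set.Icc (0 : ℝ) 1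
          · have : s - s' ∈ Set.Icc (-1 : ℝ) 1 := by
              constructor <;> linarith [hs.1, hs.2, hs'.1, hs'.2]
            simp [Set.indicator_of_mem hs', Set.indicator_of_mem this]
          · simp [Set.indicator_of_notMem hs']
  rw [h1]
  refine ne_top_of_le_ne_top (b := ENNReal.ofReal (β / 2) * L + ENNReal.ofReal K) ?_ ?_
  · exact ENNReal.add_ne_top.2 ⟨ENNReal.mul_ne_top ENNReal.ofReal_ne_top
      lintegral_negLog_abs_Icc.ne, ENNReal.ofReal_ne_top⟩
  · calc ∫⁻ s, ∫⁻ s', k s s' ∂ρ ∂ρ ≤ ∫⁻ s, ENNReal.ofReal (β / 2) * L + ENNReal.ofReal K ∂ρ :=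
          setLIntegral_mono measurable_const hinner
      _ = _ := by simp

end FiniteEnergy

/-! ### Approximation in energy by compactly supported bounded densities -/

section Regularization

variable {E : Type*} [NormedAddCommGroup E] [InnerProductSpace ℝ E]
  {β C : ℝ} {V : E → ℝ} [FiniteDimensional ℝ E] [MeasureSpace E] [BorelSpace E]

/-- Restricting to a large ball changes the energy by an arbitrarily small amount. -/
lemma exists_compactSupport_mutualEnergy_lt {μ : ProbabilityMeasure E} {b : ℝ≥0∞}
    (hμ : mutualEnergy β C V μ μ < b) :
    ∃ (ν : ProbabilityMeasure E) (R : ℝ), (ν : Measure E) (Metric.closedBall 0 R)ᶜ = 0 ∧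
      mutualEnergy β C V ν ν < b := by
  set m : Measure E := (μ : Measure E) with hm
  have h1 : Tendsto (fun n : ℕ => m (Metric.closedBall 0 n)) atTop (𝓝 1) := by
    have h := tendsto_measure_iUnion_atTop (μ := m)
      (s := fun n : ℕ => Metric.closedBall (0 : E) n)
      fun i j hij => Metric.closedBall_subset_closedBall (by exact_mod_cast hij)
    simpa [Metric.iUnion_closedBall_nat, Function.comp_def] using h
  -- Since the kernel is nonnegative, conditioning on a ball raises the energy at most by the two
  -- normalizing factors, which tend to 1.
  have h2 : Tendsto (fun n : ℕ => (m (Metric.closedBall 0 n))⁻¹ *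
      ((m (Metric.closedBall 0 n))⁻¹ * mutualEnergy β C V m m)) atTop
      (𝓝 (mutualEnergy β C V m m)) := by
    have h3 : Tendsto (fun n : ℕ => (m (Metric.closedBall 0 n))⁻¹) atTop (𝓝 1) := by
      simpa using tendsto_inv_iff.2 h1
    have h4 := ENNReal.Tendsto.mul_const (b := mutualEnergy β C V m m) h3 (Or.inl one_ne_zero)
    have h5 := ENNReal.Tendsto.mul h3 (Or.inl one_ne_zero) h4 (Or.inr ENNReal.one_ne_top)
    simpa using h5
  obtain ⟨n, hn, hn0⟩ := ((h2.eventually_lt_const hμ).and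
    (h1.eventually_const_lt zero_lt_one)).exists
  set B := Metric.closedBall (0 : E) n
  have hB : MeasurableSet B := Metric.isClosed_closedBall.measurableSet
  have hp : IsProbabilityMeasure (ProbabilityTheory.cond m B) :=
    ProbabilityTheory.cond_isProbabilityMeasure hn0.ne'
  refine ⟨⟨ProbabilityTheory.cond m B, hp⟩, n, ?_, ?_⟩
  · change ProbabilityTheory.cond m B Bᶜ = 0
    rw [ProbabilityTheory.cond_apply hB]
    simp
  · refine lt_of_le_of_lt ?_ hn
    change mutualEnergy β C V (ProbabilityTheory.cond m B) (ProbabilityTheory.cond m B) ≤ _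
    unfold mutualEnergy ProbabilityTheory.cond
    rw [Measure.prod_smul_left, Measure.prod_smul_right, lintegral_smul_measure,
      lintegral_smul_measure, Measure.prod_restrict, smul_eq_mul, smul_eq_mul]
    gcongr
    exact Measure.restrict_le_self

lemma negLog_pairWeight_add_le {x y u : E} {ε : ℝ} (hβ : 0 < β) (hC : LogConfining β C V)
    (hε : 0 ≤ ε) (hx : V (u + x) ≤ V x + ε) (hy : V (u + y) ≤ V y + ε) :
    negLog (pairWeight β C V (u + x) (u + y)) ≤
      negLog (pairWeight β C V x y) + ENNReal.ofReal ε := by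
  rw [← negLog_exp_neg, ← negLog_mul (pairWeight_nonneg _ _) (pairWeight_le_one hβ hC _ _)
    (Real.exp_pos _).le (Real.exp_le_one_iff.2 (by linarith))]
  refine negLog_antitone ?_
  unfold pairWeight
  rw [add_sub_add_left_eq_sub, mul_assoc, ← Real.exp_add]
  gcongr
  linarith

/-- The logarithmic interaction is translation invariant, so only the variation of V on the support
costs energy. -/
lemma mutualEnergy_translate_le {ν : Measure E} [IsProbabilityMeasure ν] {u : E} {ε R : ℝ}
    (hβ : 0 < β) (hV : Continuous V) (hC : LogConfining β C V) (hε : 0 ≤ ε)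
    (hR : ν (Metric.closedBall 0 R)ᶜ = 0)
    (hu : ∀ x ∈ Metric.closedBall (0 : E) R, V (u + x) ≤ V x + ε) :
    mutualEnergy β C V (ν.map (u + ·)) (ν.map (u + ·)) ≤
      mutualEnergy β C V ν ν + ENNReal.ofReal ε := by
  have hm : Measurable fun x : E => u + x := measurable_const_add u
  have hae : ∀ᵐ x ∂ν, x ∈ Metric.closedBall (0 : E) R := hR
  have hae2 : ∀ᵐ z ∂(ν.prod ν), z.1 ∈ Metric.closedBall (0 : E) R ∧
      z.2 ∈ Metric.closedBall (0 : E) R :=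
    (Measure.quasiMeasurePreserving_fst.ae hae).and (Measure.quasiMeasurePreserving_snd.ae hae)
  unfold mutualEnergy
  rw [Measure.map_prod_map _ _ hm hm,
    lintegral_map (measurable_negLog_pairWeight hβ hV) (hm.prodMap hm)]
  calc ∫⁻ z, negLog (pairWeight β C V (u + z.1) (u + z.2)) ∂(ν.prod ν)
      ≤ ∫⁻ z, negLog (pairWeight β C V z.1 z.2) + ENNReal.ofReal ε ∂(ν.prod ν) := by
        refine lintegral_mono_ae (hae2.mono fun z hz => ?_)
        exact negLog_pairWeight_add_le hβ hC hε (hu _ hz.1) (hu _ hz.2)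
    _ = _ := by
        rw [lintegral_add_right _ measurable_const]
        simp

open scoped MeasureTheory.Measure in
lemma lintegral_conv_prod_conv {ν ρ : Measure E} [SFinite ν] [SFinite ρ] {k : E → E → ℝ≥0∞}
    (hk : Measurable fun z : E × E => k z.1 z.2) :
    ∫⁻ z : E × E, k z.1 z.2 ∂((ρ ∗ ν).prod (ρ ∗ ν)) =
      ∫⁻ u, ∫⁻ v, ∫⁻ x, ∫⁻ y, k (u + x) (v + y) ∂ν ∂ν ∂ρ ∂ρ := by
  have h0 : Measurable fun x => ∫⁻ y, k x y ∂(ρ ∗ ν) := hk.lintegral_prod_right'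
  have h1 : ∫⁻ z : E × E, k z.1 z.2 ∂((ρ ∗ ν).prod (ρ ∗ ν)) =
      ∫⁻ x, ∫⁻ y, k x y ∂(ρ ∗ ν) ∂(ρ ∗ ν) := lintegral_prod _ hk.aemeasurable
  have h2 : ∫⁻ x, ∫⁻ y, k x y ∂(ρ ∗ ν) ∂(ρ ∗ ν) =
      ∫⁻ u, ∫⁻ x, ∫⁻ y, k (u + x) y ∂(ρ ∗ ν) ∂ν ∂ρ := Measure.lintegral_conv h0
  rw [h1, h2]
  refine lintegral_congr fun u => ?_
  have h3 : ∀ x : E, ∫⁻ y, k (u + x) y ∂(ρ ∗ ν) = ∫⁻ v, ∫⁻ y, k (u + x) (v + y) ∂ν ∂ρ := fun x =>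
    Measure.lintegral_conv (f := fun y => k (u + x) y)
      (hk.comp (measurable_const.prodMk measurable_id))
  simp_rw [h3]
  have h4 : Measurable fun p : (E × E) × E => k (u + p.1.1) (p.1.2 + p.2) :=
    hk.comp (by fun_prop : Measurable fun p : (E × E) × E => (u + p.1.1, p.1.2 + p.2))
  have h6 : Measurable fun p : E × E => ∫⁻ y, k (u + p.1) (p.2 + y) ∂ν := h4.lintegral_prod_right'
  exact lintegral_lintegral_swap (f := fun x v => ∫⁻ y, k (u + x) (v + y) ∂ν) h6.aemeasurable

open scoped MeasureTheory.Measure in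
-- The energy of a convolution is the average over u, v of the mutual energies of two translates of
-- ν. Convexity bounds each mixed term by the mean of two self-energies, so no estimate of the
-- kernel under relative displacement is needed.
lemma mutualEnergy_conv_le {ν ρ : Measure E} [IsProbabilityMeasure ν] [IsProbabilityMeasure ρ]
    (hβ : 0 < β) (hV : Continuous V) (hC : LogConfining β C V) {b : ℝ≥0∞}
    (h : ∀ᵐ u ∂ρ, mutualEnergy β C V (ν.map (u + ·)) (ν.map (u + ·)) ≤ b) :
    mutualEnergy β C V (ρ ∗ ν) (ρ ∗ ν) ≤ b := by
  have hk := measurable_negLog_pairWeight (C := C) hβ hV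
  have hm : ∀ u : E, Measurable fun x : E => u + x := fun u => measurable_const_add u
  have hp : ∀ u : E, IsProbabilityMeasure (ν.map (u + ·)) := fun u =>
    Measure.isProbabilityMeasure_map (hm u).aemeasurable
  have h1 : ∀ u v : E, mutualEnergy β C V (ν.map (u + ·)) (ν.map (v + ·)) =
      ∫⁻ x, ∫⁻ y, negLog (pairWeight β C V (u + x) (v + y)) ∂ν ∂ν := by
    intro u v
    unfold mutualEnergy
    rw [Measure.map_prod_map _ _ (hm u) (hm v), lintegral_map hk ((hm u).prodMap (hm v))]
    exact lintegral_prod _ (hk.comp ((hm u).prodMap (hm v))).aemeasurable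
  have h2 : mutualEnergy β C V (ρ ∗ ν) (ρ ∗ ν) =
      ∫⁻ u, ∫⁻ v, mutualEnergy β C V (ν.map (u + ·)) (ν.map (v + ·)) ∂ρ ∂ρ := by
    simp_rw [h1]
    exact lintegral_conv_prod_conv (k := fun x y => negLog (pairWeight β C V x y)) hk
  rw [h2]
  have h5 : ∀ u v, mutualEnergy β C V (ν.map (u + ·)) (ν.map (u + ·)) ≤ b →
      mutualEnergy β C V (ν.map (v + ·)) (ν.map (v + ·)) ≤ b →
      mutualEnergy β C V (ν.map (u + ·)) (ν.map (v + ·)) ≤ b := by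
    intro u v hu hv
    have h6 : 2 * mutualEnergy β C V (ν.map (u + ·)) (ν.map (v + ·)) ≤ 2 * b :=
      (two_mul_mutualEnergy_le hβ hV hC _ _).trans ((add_le_add hu hv).trans (two_mul b).ge)
    exact (ENNReal.mul_le_mul_iff_right (by simp) (by simp)).1 h6
  calc ∫⁻ u, ∫⁻ v, mutualEnergy β C V (ν.map (u + ·)) (ν.map (v + ·)) ∂ρ ∂ρ
      ≤ ∫⁻ u, ∫⁻ v, b ∂ρ ∂ρ :=
        lintegral_mono_ae (h.mono fun u hu => lintegral_mono_ae (h.mono fun v hv => h5 u v hu hv))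
    _ = b := by simp

open scoped MeasureTheory.Measure in
/-- Measures with bounded density and bounded support are dense in energy. -/
lemma exists_regular_mutualEnergy_lt [(volume : Measure E).IsAddHaarMeasure] (hβ : 0 < β)
    (hV : Continuous V) (hC : LogConfining β C V)
    {μ : ProbabilityMeasure E} {b : ℝ≥0∞} (hμ : mutualEnergy β C V μ μ < b) :
    ∃ (η : ProbabilityMeasure E) (R : ℝ) (M : ℝ≥0∞), M ≠ ⊤ ∧ (η : Measure E) ≤ M • volume ∧
      (η : Measure E) (Metric.closedBall 0 R)ᶜ = 0 ∧ mutualEnergy β C V η η < b := by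
  obtain ⟨ν, R, hR, hν⟩ := exists_compactSupport_mutualEnergy_lt hμ
  obtain ⟨ε, hε0, hε⟩ : ∃ ε : ℝ, 0 < ε ∧ mutualEnergy β C V ν ν + ENNReal.ofReal ε < b := by
    obtain ⟨r, hr0, hr⟩ := ENNReal.lt_iff_exists_add_pos_lt.1 hν
    exact ⟨r, by exact_mod_cast hr0, by simpa using hr⟩
  obtain ⟨δ, hδ0, hδ⟩ : ∃ δ : ℝ, 0 < δ ∧ ∀ u ∈ Metric.ball (0 : E) δ,
      ∀ x ∈ Metric.closedBall (0 : E) R, V (u + x) ≤ V x + ε := by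
    have huc : UniformContinuousOn V (Metric.closedBall 0 (R + 1)) :=
      (isCompact_closedBall _ _).uniformContinuousOn_of_continuous hV.continuousOn
    obtain ⟨δ, hδ0, hδ⟩ := Metric.uniformContinuousOn_iff.1 huc ε hε0
    refine ⟨min δ 1, by positivity, fun u hu x hx => ?_⟩
    rw [mem_ball_zero_iff, lt_min_iff] at hu
    rw [mem_closedBall_zero_iff] at hx
    have h := hδ (u + x) (by
      rw [mem_closedBall_zero_iff]
      linarith [norm_add_le u x]) x (by
      rw [mem_closedBall_zero_iff]
      linarith) (by simpa using hu.1)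
    rw [Real.dist_eq, abs_lt] at h
    linarith
  set B := Metric.ball (0 : E) δ
  have hB : MeasurableSet B := Metric.isOpen_ball.measurableSet
  have hB0 : volume B ≠ 0 := (Metric.measure_ball_pos _ _ hδ0).ne'
  have hB1 : volume B ≠ ⊤ := measure_ball_lt_top.ne
  -- Uniform law on a small ball: its density is at most 1/vol(B), a bound that convolution with ν
  -- preserves.
  set ρ : Measure E := ProbabilityTheory.cond volume B
  have hρ : IsProbabilityMeasure ρ :=
    ProbabilityTheory.cond_isProbabilityMeasure_of_finite hB0 hB1
  have hρB : ∀ᵐ u ∂ρ, u ∈ B := by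
    change ρ Bᶜ = 0
    rw [ProbabilityTheory.cond_apply hB]
    simp
  have hρle : ρ ≤ (volume B)⁻¹ • volume := by
    refine Measure.le_iff.2 fun s hs => ?_
    rw [ProbabilityTheory.cond_apply hB, Measure.smul_apply, smul_eq_mul]
    gcongr
    exact Set.inter_subset_right
  refine ⟨⟨ρ ∗ (ν : Measure E), inferInstance⟩, R + δ, (volume B)⁻¹, by simpa using hB0, ?_, ?_, ?_⟩
  · change ρ ∗ (ν : Measure E) ≤ _
    refine Measure.le_iff.2 fun s hs => ?_
    rw [Measure.conv_comm, ← lintegral_indicator_one hs,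
      Measure.lintegral_conv (measurable_one.indicator hs)]
    have h1 : ∀ x : E, ∫⁻ y, s.indicator 1 (x + y) ∂ρ ≤ ((volume B)⁻¹ • volume) s := by
      intro x
      calc ∫⁻ y, s.indicator 1 (x + y) ∂ρ
          ≤ ∫⁻ y, s.indicator 1 (x + y) ∂((volume B)⁻¹ • volume) := lintegral_mono' hρle le_rfl
        _ = (volume B)⁻¹ * ∫⁻ y, s.indicator 1 (x + y) := by
          rw [lintegral_smul_measure, smul_eq_mul]
        _ = ((volume B)⁻¹ • volume) s := by
          rw [lintegral_add_left_eq_self, lintegral_indicator_one hs, Measure.smul_apply,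
            smul_eq_mul]
    calc ∫⁻ x, ∫⁻ y, s.indicator 1 (x + y) ∂ρ ∂(ν : Measure E)
        ≤ ∫⁻ x, ((volume B)⁻¹ • volume) s ∂(ν : Measure E) := lintegral_mono h1
      _ = _ := by simp
  · change (ρ ∗ (ν : Measure E)) _ = 0
    have hs : MeasurableSet (Metric.closedBall (0 : E) (R + δ))ᶜ :=
      Metric.isClosed_closedBall.measurableSet.compl
    rw [← lintegral_indicator_one hs, Measure.lintegral_conv (measurable_one.indicator hs)]
    have hνR : ∀ᵐ x ∂(ν : Measure E), x ∈ Metric.closedBall (0 : E) R := hR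
    rw [← lintegral_zero (μ := ρ)]
    refine lintegral_congr_ae (hρB.mono fun u hu => ?_)
    change ∫⁻ y, _ ∂(ν : Measure E) = 0
    rw [← lintegral_zero (μ := (ν : Measure E))]
    refine lintegral_congr_ae (hνR.mono fun x hx => ?_)
    have hmem : u + x ∈ Metric.closedBall (0 : E) (R + δ) := by
      rw [mem_closedBall_zero_iff] at hx ⊢
      rw [mem_ball_zero_iff] at hu
      linarith [norm_add_le u x]
    exact Set.indicator_of_notMem (Set.notMem_compl_iff.2 hmem) _
  · refine lt_of_le_of_lt (mutualEnergy_conv_le hβ hV hC (hρB.mono fun u hu => ?_)) hε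
    exact mutualEnergy_translate_le hβ hV hC hε0.le hR (hδ u hu)

end Regularization

/-! ### Rewriting the gas density through pair factors -/

section Interaction

variable {E : Type*} [NormedAddCommGroup E] {β C : ℝ} {V : E → ℝ} {N : ℕ}

/-- The product of the pair interaction factors over ordered pairs of distinct particles. -/
def interaction (β C : ℝ) (V : E → ℝ) (N : ℕ) (x : Fin N → E) : ℝ :=
  ∏ i : Fin N, ∏ j ∈ ({i}ᶜ : Finset (Fin N)), pairWeight β C V (x i) (x j)

lemma interaction_nonneg (x : Fin N → E) : 0 ≤ interaction β C V N x :=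
  Finset.prod_nonneg fun _ _ => Finset.prod_nonneg fun _ _ => pairWeight_nonneg _ _

/-- Each particle belongs to 2(N−1) ordered pairs, with weight 1/2 in each; this is where the N−1
copies of V go. -/
lemma sum_sum_compl (f : Fin N → ℝ) (c : ℝ) :
    ∑ i : Fin N, ∑ j ∈ ({i}ᶜ : Finset (Fin N)), ((f i + f j) / 2 + c) =
      (N - 1) * ∑ i, f i + c * (N * (N - 1)) := by
  have h : ∀ i : Fin N, ∑ j ∈ ({i}ᶜ : Finset (Fin N)), ((f i + f j) / 2 + c) =
      (N * (f i / 2 + c) + (∑ j, f j) / 2) - (f i + c) := by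
    intro i
    have h1 : ∑ j : Fin N, ((f i + f j) / 2 + c) = N * (f i / 2 + c) + (∑ j, f j) / 2 := by
      rw [Finset.sum_congr rfl fun j _ => show (f i + f j) / 2 + c = (f i / 2 + c) + f j / 2 by ring,
        Finset.sum_add_distrib, ← Finset.sum_div]
      simp
      ring
    rw [← h1, ← Finset.sum_add_sum_compl {i} (fun j => (f i + f j) / 2 + c), Finset.sum_singleton]
    ring
  simp_rw [h]
  rw [Finset.sum_sub_distrib, Finset.sum_add_distrib, ← Finset.mul_sum, Finset.sum_add_distrib,
    Finset.sum_add_distrib, ← Finset.sum_div]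
  simp only [Finset.sum_const, Finset.card_univ, Fintype.card_fin, nsmul_eq_mul]
  ring

/-- The exponent β over unordered pairs becomes β/2 over ordered ones. The pairs use N−1 of the N
copies of V, leaving one e^{−V} per particle to ensure integrability, and the shift by C is restored
in front. -/
lemma gasWeight_eq (x : Fin N → E) : gasWeight β V N x =
    Real.exp (C * (N * (N - 1))) * (interaction β C V N x * ∏ i, Real.exp (-V (x i))) := by
  have h1 : ∏ i : Fin N, ∏ j ∈ Finset.Ioi i, ‖x i - x j‖ ^ β =
      ∏ i : Fin N, ∏ j ∈ ({i}ᶜ : Finset (Fin N)), ‖x i - x j‖ ^ (β / 2) := by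
    rw [← Finset.prod_prod_Ioi_mul_eq_prod_prod_off_diag (fun j i => ‖x i - x j‖ ^ (β / 2))]
    refine Finset.prod_congr rfl fun i _ => Finset.prod_congr rfl fun j hj => ?_
    have hpow : ∀ r : ℝ, 0 ≤ r → r ^ β = r ^ (β / 2) * r ^ (β / 2) := by
      intro r hr
      rw [← sq, ← Real.rpow_natCast, ← Real.rpow_mul hr]
      congr 1
      push_cast
      ring
    rw [hpow _ (norm_nonneg _), norm_sub_rev (x j)]
  have h2 : interaction β C V N x =
      (∏ i : Fin N, ∏ j ∈ ({i}ᶜ : Finset (Fin N)), ‖x i - x j‖ ^ (β / 2)) *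
        Real.exp (-((N - 1) * ∑ i, V (x i) + C * (N * (N - 1)))) := by
    unfold interaction pairWeight
    simp_rw [Finset.prod_mul_distrib, ← Real.exp_sum, Finset.sum_neg_distrib]
    rw [sum_sum_compl]
  unfold gasWeight
  rw [h1, h2, ← Real.exp_sum, ← Real.exp_sum, Finset.sum_neg_distrib, Finset.sum_neg_distrib,
    ← Finset.mul_sum, mul_assoc, ← Real.exp_add, mul_left_comm, ← Real.exp_add]
  congr 2
  ring

lemma continuous_interaction (hβ : 0 < β) (hV : Continuous V) :
    Continuous (interaction β C V N) := by
  unfold interaction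
  refine continuous_finsetProd _ fun i _ => continuous_finsetProd _ fun j _ => ?_
  exact (continuous_pairWeight hβ hV).comp (by fun_prop : Continuous fun x : Fin N → E => (x i, x j))

lemma continuous_gasWeight (hβ : 0 < β) (hV : Continuous V) :
    Continuous (gasWeight β V N) := by
  have h := continuous_interaction (C := 0) (N := N) hβ hV
  rw [funext (gasWeight_eq (β := β) (V := V) (C := 0) (N := N))]
  fun_prop

end Interaction

/-! ### Upper bounds for the gas weight -/

section Bounds

variable {E : Type*} [NormedAddCommGroup E] [InnerProductSpace ℝ E]
  {β C : ℝ} {V : E → ℝ} {N : ℕ}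

lemma interaction_le_one (hβ : 0 < β) (hC : LogConfining β C V) (x : Fin N → E) :
    interaction β C V N x ≤ 1 :=
  Finset.prod_le_one (fun _ _ => Finset.prod_nonneg fun _ _ => pairWeight_nonneg _ _) fun _ _ =>
    Finset.prod_le_one (fun _ _ => pairWeight_nonneg _ _) fun _ _ => pairWeight_le_one hβ hC _ _

lemma negLog_one : negLog 1 = 0 := by simp [negLog_of_pos]

lemma negLog_prod {ι : Type*} (s : Finset ι) (f : ι → ℝ) (h0 : ∀ i ∈ s, 0 ≤ f i)
    (h1 : ∀ i ∈ s, f i ≤ 1) : negLog (∏ i ∈ s, f i) = ∑ i ∈ s, negLog (f i) := by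
  classical
  induction s using Finset.induction_on with
  | empty => simp [negLog_one]
  | insert a s ha ih =>
    rw [Finset.prod_insert ha, Finset.sum_insert ha,
      negLog_mul (h0 a (Finset.mem_insert_self a s)) (h1 a (Finset.mem_insert_self a s)), ih]
    · exact fun i hi => h0 i (Finset.mem_insert_of_mem hi)
    · exact fun i hi => h1 i (Finset.mem_insert_of_mem hi)
    · exact Finset.prod_nonneg fun i hi => h0 i (Finset.mem_insert_of_mem hi)
    · exact Finset.prod_le_one (fun i hi => h0 i (Finset.mem_insert_of_mem hi))
        fun i hi => h1 i (Finset.mem_insert_of_mem hi)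

lemma negLog_interaction (hβ : 0 < β) (hC : LogConfining β C V) (x : Fin N → E) :
    negLog (interaction β C V N x) =
      ∑ i : Fin N, ∑ j ∈ ({i}ᶜ : Finset (Fin N)), negLog (pairWeight β C V (x i) (x j)) := by
  unfold interaction
  rw [negLog_prod]
  · refine Finset.sum_congr rfl fun i _ => negLog_prod _ _ (fun _ _ => pairWeight_nonneg _ _)
      fun _ _ => pairWeight_le_one hβ hC _ _
  · exact fun _ _ => Finset.prod_nonneg fun _ _ => pairWeight_nonneg _ _
  · exact fun _ _ => Finset.prod_le_one (fun _ _ => pairWeight_nonneg _ _)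
      fun _ _ => pairWeight_le_one hβ hC _ _

variable [FiniteDimensional ℝ E] [MeasureSpace E] [BorelSpace E]
  [(volume : Measure E).IsAddHaarMeasure]

lemma lintegral_prod_exp_neg (hint : Integrable fun x : E => Real.exp (-V x)) :
    ∫⁻ x : Fin N → E, ENNReal.ofReal (∏ i, Real.exp (-V (x i))) =
      ENNReal.ofReal (∫ x : E, Real.exp (-V x)) ^ N := by
  rw [← ofReal_integral_eq_lintegral_ofReal]
  · have h := integral_fintype_prod_volume_eq_prod (𝕜 := ℝ) (ι := Fin N) (E := fun _ => E)
      (fun _ x => Real.exp (-V x))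
    rw [h, Finset.prod_const, Finset.card_univ, Fintype.card_fin, ENNReal.ofReal_pow]
    exact integral_nonneg fun x => (Real.exp_pos _).le
  · exact Integrable.fintype_prod (𝕜 := ℝ) (ι := Fin N) (E := E) (μ := fun _ => volume)
      (f := fun _ x => Real.exp (-V x)) fun _ => hint
  · exact ae_of_all _ fun x => Finset.prod_nonneg fun i _ => (Real.exp_pos _).le

/-- Upper bound for the mass of the configurations with small interaction factor. -/
lemma setLIntegral_gasWeight_le (hV : Continuous V)
    (hint : Integrable fun x : E => Real.exp (-V x)) (s : ℝ) :
    ∫⁻ x in {x : Fin N → E | interaction β C V N x ≤ s}, ENNReal.ofReal (gasWeight β V N x) ≤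
      ENNReal.ofReal (Real.exp (C * (N * (N - 1)))) *
        (ENNReal.ofReal s * ENNReal.ofReal (∫ x : E, Real.exp (-V x)) ^ N) := by
  have hm : Measurable fun x : Fin N → E => ENNReal.ofReal (∏ i, Real.exp (-V (x i))) := by
    have := hV.measurable
    fun_prop
  calc ∫⁻ x in {x : Fin N → E | interaction β C V N x ≤ s}, ENNReal.ofReal (gasWeight β V N x)
      ≤ ∫⁻ x in {x : Fin N → E | interaction β C V N x ≤ s},
          ENNReal.ofReal (Real.exp (C * (N * (N - 1)))) *
            (ENNReal.ofReal s * ENNReal.ofReal (∏ i, Real.exp (-V (x i)))) := by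
        refine setLIntegral_mono (by fun_prop) fun x hx => ?_
        have hp : 0 ≤ ∏ i, Real.exp (-V (x i)) := Finset.prod_nonneg fun i _ => (Real.exp_pos _).le
        rw [gasWeight_eq (C := C), ENNReal.ofReal_mul (Real.exp_pos _).le,
          ENNReal.ofReal_mul (interaction_nonneg x)]
        gcongr
        exact hx
    _ ≤ ∫⁻ x : Fin N → E, ENNReal.ofReal (Real.exp (C * (N * (N - 1)))) *
            (ENNReal.ofReal s * ENNReal.ofReal (∏ i, Real.exp (-V (x i)))) :=
        setLIntegral_le_lintegral _ _
    _ = _ := by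
        rw [lintegral_const_mul _ (by fun_prop), lintegral_const_mul _ hm,
          lintegral_prod_exp_neg hint]

lemma partitionFunction_lt_top (hβ : 0 < β) (hV : Continuous V) (hC : LogConfining β C V)
    (hint : Integrable fun x : E => Real.exp (-V x)) : partitionFunction β V N < ⊤ := by
  have h := setLIntegral_gasWeight_le (C := C) (N := N) (β := β) hV hint 1
  have hu : {x : Fin N → E | interaction β C V N x ≤ 1} = Set.univ :=
    Set.eq_univ_of_forall fun x => interaction_le_one hβ hC x
  rw [hu, setLIntegral_univ] at h
  refine lt_of_le_of_lt h ?_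
  exact ENNReal.mul_lt_top ENNReal.ofReal_lt_top
    (ENNReal.mul_lt_top ENNReal.ofReal_lt_top (ENNReal.pow_lt_top ENNReal.ofReal_lt_top))

end Bounds

/-! ### Product measures and Jensen's inequality -/

section ProductMeasure

lemma measurePreserving_eval_pair {E : Type*} [MeasurableSpace E] {N : ℕ} {η : Measure E} [IsProbabilityMeasure η]
    {i j : Fin N} (hij : i ≠ j) :
    MeasurePreserving (fun x : Fin N → E => (x i, x j)) (Measure.pi fun _ => η) (η.prod η) := by
  have hind := (ProbabilityTheory.iIndepFun_pi (μ := fun _ : Fin N => η)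
    (X := fun _ => (id : E → E)) fun _ => aemeasurable_id).indepFun hij
  refine ⟨by fun_prop, ?_⟩
  have h := (ProbabilityTheory.indepFun_iff_map_prod_eq_prod_map_map
    (measurable_pi_apply i).aemeasurable (measurable_pi_apply j).aemeasurable).1 hind
  refine h.trans ?_
  congr 1
  · exact (measurePreserving_eval (fun _ : Fin N => η) i).map_eq
  · exact (measurePreserving_eval (fun _ : Fin N => η) j).map_eq

variable {E : Type*} [MeasureSpace E] {N : ℕ}

/-- Allows integrals over Lebesgue measure on E^N to be bounded below by integrals over η^{⊗N}, at a
cost M^N that is negligible at scale N². -/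
lemma pi_smul_le_volume [SigmaFinite (volume : Measure E)] {η : Measure E}
    [IsProbabilityMeasure η] {M : ℝ≥0∞} (hM : M ≠ ⊤) (hη : η ≤ M • volume) :
    (M ^ N)⁻¹ • Measure.pi (fun _ : Fin N => η) ≤ volume := by
  refine Measure.le_iff.2 fun s hs => ?_
  rw [volume_pi]
  -- At the level of outer measures the product is the largest one bounded by the product of volumes
  -- on boxes, so it suffices to compare on boxes.
  conv_rhs => rw [Measure.pi, toMeasure_apply _ _ hs]
  suffices h : ((M ^ N)⁻¹ • Measure.pi (fun _ : Fin N => η)).toOuterMeasure ≤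
      OuterMeasure.pi fun _ : Fin N => (volume : Measure E).toOuterMeasure from h s
  rw [OuterMeasure.le_pi]
  intro t _
  change (M ^ N)⁻¹ * Measure.pi (fun _ : Fin N => η) (Set.univ.pi t) ≤ ∏ i, volume (t i)
  have h1 : ∏ i, η (t i) ≤ M ^ N * ∏ i, volume (t i) := by
    calc ∏ i, η (t i) ≤ ∏ i, M * volume (t i) := Finset.prod_le_prod' fun i _ => hη (t i)
      _ = _ := by rw [Finset.prod_mul_distrib]; simp
  have hM0 : M ≠ 0 := by
    rintro rfl
    have := hη Set.univ
    simp at this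
  rw [Measure.pi_pi]
  calc (M ^ N)⁻¹ * ∏ i, η (t i) ≤ (M ^ N)⁻¹ * (M ^ N * ∏ i, volume (t i)) := by gcongr
    _ = ∏ i, volume (t i) := by
      rw [← mul_assoc, ENNReal.inv_mul_cancel (pow_ne_zero _ hM0) (ENNReal.pow_ne_top hM), one_mul]

/-- Jensen's inequality for the exponential function. -/
lemma ofReal_exp_neg_integral_le {Ω : Type*} [MeasurableSpace Ω] {P : Measure Ω}
    [IsProbabilityMeasure P] {g : Ω → ℝ} (hg : Integrable g P) :
    ENNReal.ofReal (Real.exp (-∫ x, g x ∂P)) ≤ ∫⁻ x, ENNReal.ofReal (Real.exp (-g x)) ∂P := by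
  set m := ∫ x, g x ∂P
  -- The tangent line to g ↦ e^{−g} at the mean m: it lies below the exponential and its integral is
  -- e^{−m}.
  set f : Ω → ℝ := fun x => Real.exp (-m) * (1 + (m - g x)) with hf
  have hfi : Integrable f P :=
    ((integrable_const 1).add ((integrable_const m).sub hg)).const_mul _
  have h1 : ∫ x, f x ∂P = Real.exp (-m) := by
    have hsub : ∫ x, m - g x ∂P = 0 := by
      rw [integral_sub (integrable_const m) hg]
      simp [m]
    have hi : Integrable (fun x => m - g x) P := (integrable_const m).sub hg
    rw [hf, integral_const_mul, integral_add (integrable_const 1) hi, hsub]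
    simp
  have h2 : ∀ x, f x ≤ Real.exp (-g x) := by
    intro x
    have := Real.add_one_le_exp (m - g x)
    calc f x ≤ Real.exp (-m) * Real.exp (m - g x) := by
          simp only [hf]
          gcongr
          linarith
      _ = Real.exp (-g x) := by rw [← Real.exp_add]; ring_nf
  have h3 : ENNReal.ofReal (∫ x, f x ∂P) ≤ ∫⁻ x, ENNReal.ofReal (f x) ∂P := by
    rw [integral_eq_lintegral_pos_part_sub_lintegral_neg_part hfi]
    refine (ENNReal.ofReal_le_ofReal (sub_le_self _ ENNReal.toReal_nonneg)).trans ?_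
    exact ENNReal.ofReal_toReal_le
  rw [← h1]
  exact h3.trans (lintegral_mono fun x => ENNReal.ofReal_le_ofReal (h2 x))

end ProductMeasure

/-! ### Lower bound for the partition function -/

section LowerBound

variable {E : Type*} [NormedAddCommGroup E] [InnerProductSpace ℝ E]
  {β C : ℝ} {V : E → ℝ} [FiniteDimensional ℝ E] [MeasureSpace E] [BorelSpace E]
  [(volume : Measure E).IsAddHaarMeasure]

/-- Lower bound for the partition function. -/
lemma le_partitionFunction (N : ℕ) (hβ : 0 < β) (hV : Continuous V) (hC : LogConfining β C V)
    {η : Measure E} [IsProbabilityMeasure η] {M : ℝ≥0∞} (hM : M ≠ ⊤) (hη : η ≤ M • volume)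
    (hVη : Integrable V η) (hfin : mutualEnergy β C V η η ≠ ⊤) :
    (M ^ N)⁻¹ * (ENNReal.ofReal (Real.exp (C * (N * (N - 1)))) *
      ENNReal.ofReal (Real.exp (-(N * (N - 1) * (mutualEnergy β C V η η).toReal +
        N * ∫ x, V x ∂η)))) ≤ partitionFunction β V N := by
  set P : Measure (Fin N → E) := Measure.pi fun _ => η
  -- A real-valued version of the kernel. Because `Real.log 0 = 0` it is wrong where the factor
  -- vanishes, which is a null set for η × η as the energy is finite.
  set k : E × E → ℝ := fun z => -Real.log (pairWeight β C V z.1 z.2) with hk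
  have hφ := continuous_pairWeight (C := C) hβ hV
  have hkm : Measurable k := (Real.measurable_log.comp hφ.measurable).neg
  have hk0 : ∀ z, 0 ≤ k z := fun z =>
    neg_nonneg.2 (Real.log_nonpos (pairWeight_nonneg _ _) (pairWeight_le_one hβ hC _ _))
  have hkle : ∀ z : E × E, ENNReal.ofReal (k z) ≤ negLog (pairWeight β C V z.1 z.2) := by
    intro z
    unfold negLog
    split_ifs with h
    · exact le_top
    · exact le_rfl
  have hklint : ∫⁻ z, ENNReal.ofReal (k z) ∂(η.prod η) ≤ mutualEnergy β C V η η :=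
    lintegral_mono hkle
  have hki : Integrable k (η.prod η) := by
    refine ⟨hkm.aestronglyMeasurable, ?_⟩
    rw [hasFiniteIntegral_iff_ofReal (ae_of_all _ hk0)]
    exact hklint.trans_lt hfin.lt_top
  have hkint : ∫ z, k z ∂(η.prod η) ≤ (mutualEnergy β C V η η).toReal := by
    rw [integral_eq_lintegral_of_nonneg_ae (ae_of_all _ hk0) hkm.aestronglyMeasurable]
    exact ENNReal.toReal_mono hfin hklint
  have hpos : ∀ᵐ z ∂(η.prod η), 0 < pairWeight β C V z.1 z.2 := by
    filter_upwards [ae_lt_top (measurable_negLog_pairWeight hβ hV) hfin] with z hz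
    by_contra hcon
    simp [negLog, not_lt.1 hcon] at hz
  have hposP : ∀ᵐ x ∂P, ∀ i : Fin N, ∀ j ∈ ({i}ᶜ : Finset (Fin N)),
      0 < pairWeight β C V (x i) (x j) := by
    refine ae_all_iff.2 fun i => (Finset.eventually_all _).2 fun j hj => ?_
    have hij : i ≠ j := fun h => by simp [h] at hj
    exact (measurePreserving_eval_pair (η := η) hij).quasiMeasurePreserving.ae hpos
  set g : (Fin N → E) → ℝ := fun x =>
    (∑ i, ∑ j ∈ ({i}ᶜ : Finset (Fin N)), k (x i, x j)) + ∑ i, V (x i) with hg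
  have hkP : ∀ i j : Fin N, i ≠ j → Integrable (fun x : Fin N → E => k (x i, x j)) P ∧
      ∫ x, k (x i, x j) ∂P = ∫ z, k z ∂(η.prod η) := by
    intro i j hij
    have hmp := measurePreserving_eval_pair (η := η) hij
    refine ⟨hmp.integrable_comp_of_integrable hki, ?_⟩
    rw [← hmp.map_eq, integral_map hmp.measurable.aemeasurable hkm.aestronglyMeasurable]
  have hVP : ∀ i : Fin N, Integrable (fun x : Fin N → E => V (x i)) P ∧
      ∫ x, V (x i) ∂P = ∫ x, V x ∂η := by
    intro i
    exact ⟨(measurePreserving_eval (fun _ : Fin N => η) i).integrable_comp_of_integrable hVη,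
      integral_comp_eval hV.aestronglyMeasurable⟩
  have hne : ∀ {i j : Fin N}, j ∈ ({i}ᶜ : Finset (Fin N)) → i ≠ j := fun hj h => by
    simp [h] at hj
  have hi1 : ∀ i : Fin N, Integrable
      (fun x : Fin N → E => ∑ j ∈ ({i}ᶜ : Finset (Fin N)), k (x i, x j)) P := fun i =>
    integrable_finsetSum _ fun j hj => (hkP i j (hne hj)).1
  have hi2 : Integrable
      (fun x : Fin N → E => ∑ i, ∑ j ∈ ({i}ᶜ : Finset (Fin N)), k (x i, x j)) P :=
    integrable_finsetSum _ fun i _ => hi1 i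
  have hi3 : Integrable (fun x : Fin N → E => ∑ i, V (x i)) P :=
    integrable_finsetSum _ fun i _ => (hVP i).1
  have hgi : Integrable g P := hi2.add hi3
  have hgint : ∫ x, g x ∂P ≤ N * (N - 1) * (mutualEnergy β C V η η).toReal +
      N * ∫ x, V x ∂η := by
    rw [hg, integral_add hi2 hi3, integral_finsetSum _ fun i _ => hi1 i,
      integral_finsetSum _ fun i _ => (hVP i).1]
    have h1 : ∀ i : Fin N, ∫ x, ∑ j ∈ ({i}ᶜ : Finset (Fin N)), k (x i, x j) ∂P =
        (N - 1) * ∫ z, k z ∂(η.prod η) := by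
      intro i
      have hN : 1 ≤ N := by have := i.2; omega
      rw [integral_finsetSum _ fun j hj => (hkP i j (hne hj)).1,
        Finset.sum_congr rfl fun j hj => (hkP i j (hne hj)).2, Finset.sum_const,
        Finset.card_compl, Finset.card_singleton, Fintype.card_fin, nsmul_eq_mul,
        Nat.cast_sub hN, Nat.cast_one]
    simp_rw [h1, fun i => (hVP i).2]
    simp only [Finset.sum_const, Finset.card_univ, Fintype.card_fin, nsmul_eq_mul]
    rw [← mul_assoc]
    have hN : (0 : ℝ) ≤ N * (N - 1) := by
      rcases Nat.eq_zero_or_pos N with rfl | hN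
      · simp
      · have : (1 : ℝ) ≤ N := by exact_mod_cast hN
        exact mul_nonneg (by linarith) (by linarith)
    gcongr
  have hgw : ∀ᵐ x ∂P, gasWeight β V N x = Real.exp (C * (N * (N - 1))) * Real.exp (-g x) := by
    filter_upwards [hposP] with x hx
    rw [gasWeight_eq (C := C)]
    congr 1
    have h1 : ∀ i : Fin N, ∀ j ∈ ({i}ᶜ : Finset (Fin N)), pairWeight β C V (x i) (x j) =
        Real.exp (-k (x i, x j)) := by
      intro i j hj
      rw [hk, neg_neg, Real.exp_log (hx i j hj)]
    unfold interaction
    rw [Finset.prod_congr rfl fun i _ => Finset.prod_congr rfl (h1 i)]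
    simp_rw [← Real.exp_sum, Finset.sum_neg_distrib]
    rw [← Real.exp_add, hg, neg_add]
  have hJ := ofReal_exp_neg_integral_le hgi
  have hmeas : Measurable fun x => ENNReal.ofReal (gasWeight β V N x) :=
    ENNReal.measurable_ofReal.comp (continuous_gasWeight hβ hV).measurable
  have hgm : AEMeasurable (fun x => ENNReal.ofReal (Real.exp (-g x))) P :=
    ENNReal.measurable_ofReal.comp_aemeasurable
      (Real.measurable_exp.comp_aemeasurable hgi.aemeasurable.neg)
  calc (M ^ N)⁻¹ * (ENNReal.ofReal (Real.exp (C * (N * (N - 1)))) *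
      ENNReal.ofReal (Real.exp (-(N * (N - 1) * (mutualEnergy β C V η η).toReal +
        N * ∫ x, V x ∂η))))
      ≤ (M ^ N)⁻¹ * (ENNReal.ofReal (Real.exp (C * (N * (N - 1)))) *
          ∫⁻ x, ENNReal.ofReal (Real.exp (-g x)) ∂P) := by
        gcongr
        exact (ENNReal.ofReal_le_ofReal (Real.exp_le_exp.2 (neg_le_neg hgint))).trans hJ
    _ = (M ^ N)⁻¹ * ∫⁻ x, ENNReal.ofReal (gasWeight β V N x) ∂P := by
        rw [← lintegral_const_mul'' _ hgm]
        congr 1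
        refine lintegral_congr_ae (hgw.mono fun x hx => ?_)
        dsimp only
        rw [hx, ENNReal.ofReal_mul (Real.exp_pos _).le]
    _ = ∫⁻ x, ENNReal.ofReal (gasWeight β V N x) ∂((M ^ N)⁻¹ • P) := by
        rw [lintegral_smul_measure, smul_eq_mul]
    _ ≤ partitionFunction β V N := lintegral_mono' (pi_smul_le_volume hM hη) le_rfl

end LowerBound

/-! ### Exponential concentration and almost sure convergence -/

section Concentration

variable {E : Type*} [NormedAddCommGroup E] [InnerProductSpace ℝ E]
  {β C : ℝ} {V : E → ℝ} [FiniteDimensional ℝ E] [MeasureSpace E] [BorelSpace E]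
  [(volume : Measure E).IsAddHaarMeasure]

lemma integrable_of_continuous_of_measure_compl_closedBall_eq_zero {η : Measure E}
    [IsFiniteMeasure η] (hV : Continuous V) {R : ℝ} (hR : η (Metric.closedBall 0 R)ᶜ = 0) :
    Integrable V η := by
  have h : η.restrict (Metric.closedBall 0 R) = η := Measure.restrict_eq_self_of_ae_mem hR
  rw [← h]
  exact hV.continuousOn.integrableOn_compact (isCompact_closedBall _ _)

/-- Configurations with energy larger than the minimum are exponentially unlikely. -/
lemma exists_gasMeasure_interaction_le (hβ : 0 < β) (hV : Continuous V) (hC : LogConfining β C V)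
    (hint : Integrable fun x : E => Real.exp (-V x)) {μ : ProbabilityMeasure E} {r : ℝ}
    (hμ : mutualEnergy β C V μ μ < ENNReal.ofReal r) :
    ∃ D : ℝ, ∀ N : ℕ, partitionFunction β V N ≠ 0 ∧
      gasMeasure β V N {x | interaction β C V N x ≤ Real.exp (-(N ^ 2 * r))} ≤
        ENNReal.ofReal (Real.exp D * Real.exp (-N)) := by
  obtain ⟨η, R, M, hM, hη, hR, hJ⟩ := exists_regular_mutualEnergy_lt hβ hV hC hμ
  have hfin : mutualEnergy β C V η η ≠ ⊤ := hJ.ne_top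
  have hVη : Integrable V (η : Measure E) :=
    integrable_of_continuous_of_measure_compl_closedBall_eq_zero hV hR
  have hM0 : M ≠ 0 := by
    rintro rfl
    have := hη Set.univ
    simp at this
  set J := (mutualEnergy β C V η η).toReal with hJdef
  have hJ0 : 0 ≤ J := ENNReal.toReal_nonneg
  have hJr : J < r := by
    rw [hJdef]
    have h1 := (ENNReal.lt_ofReal_iff_toReal_lt hfin).1 hJ
    exact h1
  set v := ∫ x, V x ∂(η : Measure E)
  set Z := ∫ x : E, Real.exp (-V x)
  have hZ0 : 0 ≤ Z := integral_nonneg fun x => (Real.exp_pos _).le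
  set m := M.toReal with hm
  have hm0 : 0 < m := ENNReal.toReal_pos hM0 hM
  have hMm : M = ENNReal.ofReal m := (ENNReal.ofReal_toReal hM).symm
  -- The constant a collects all factors of exponential order N: the density bound, ∫ e^{−V}, and
  -- the mean of V under η.
  obtain ⟨a, ha⟩ : ∃ a : ℝ, m * Z * Real.exp v ≤ Real.exp a :=
    (Real.tendsto_exp_atTop.eventually_ge_atTop _).exists
  set c := r - J
  have hc : 0 < c := sub_pos.2 hJr
  -- The maximum over real N of (a+1)N − cN²; the extra 1 yields the factor e^{−N}.
  refine ⟨(a + 1) ^ 2 / (4 * c), fun N => ?_⟩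
  set L : ℝ := (m ^ N)⁻¹ * (Real.exp (C * (N * (N - 1))) *
    Real.exp (-(N * (N - 1) * J + N * v))) with hL
  have hL0 : 0 < L := by positivity
  have hlow : ENNReal.ofReal L ≤ partitionFunction β V N := by
    have h := le_partitionFunction N hβ hV hC hM hη hVη hfin
    rwa [hMm, ← ENNReal.ofReal_pow hm0.le, ← ENNReal.ofReal_inv_of_pos (by positivity),
      ← ENNReal.ofReal_mul (by positivity), ← ENNReal.ofReal_mul (by positivity)] at h
  refine ⟨fun h0 => ?_, ?_⟩
  · rw [h0, nonpos_iff_eq_zero, ENNReal.ofReal_eq_zero] at hlow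
    linarith
  · have hA : MeasurableSet {x : Fin N → E |
        interaction β C V N x ≤ Real.exp (-(N ^ 2 * r))} :=
      measurableSet_le (continuous_interaction hβ hV).measurable measurable_const
    have hup := setLIntegral_gasWeight_le (β := β) (C := C) (N := N) hV hint
      (Real.exp (-(N ^ 2 * r)))
    unfold gasMeasure
    rw [Measure.smul_apply, withDensity_apply _ hA, smul_eq_mul]
    calc (partitionFunction β V N)⁻¹ * _
        ≤ (ENNReal.ofReal L)⁻¹ * (ENNReal.ofReal (Real.exp (C * (N * (N - 1)))) *
          (ENNReal.ofReal (Real.exp (-(N ^ 2 * r))) * ENNReal.ofReal Z ^ N)) := by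
          gcongr
      _ = ENNReal.ofReal (L⁻¹ * (Real.exp (C * (N * (N - 1))) *
          (Real.exp (-(N ^ 2 * r)) * Z ^ N))) := by
          rw [← ENNReal.ofReal_inv_of_pos hL0, ← ENNReal.ofReal_pow hZ0,
            ← ENNReal.ofReal_mul (by positivity), ← ENNReal.ofReal_mul (by positivity),
            ← ENNReal.ofReal_mul (by positivity)]
      _ ≤ _ := by
          refine ENNReal.ofReal_le_ofReal ?_
          -- The factors e^{CN(N−1)} of the upper and lower bounds cancel, leaving −N²(r − J) as
          -- leading exponent.
          have h1 : L⁻¹ * (Real.exp (C * (N * (N - 1))) * (Real.exp (-(N ^ 2 * r)) * Z ^ N)) =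
              (m * Z * Real.exp v) ^ N * Real.exp (N * (N - 1) * J - N ^ 2 * r) := by
            rw [hL, mul_inv, mul_inv, inv_inv, ← Real.exp_neg, ← Real.exp_neg, neg_neg, mul_pow,
              mul_pow, ← Real.exp_nat_mul]
            have h2 : Real.exp (-(C * (N * (N - 1)))) * Real.exp (C * (N * (N - 1))) = 1 := by
              rw [← Real.exp_add]; simp
            rw [sub_eq_add_neg (N * (N - 1) * J), Real.exp_add, Real.exp_add]
            linear_combination (m ^ N * (Real.exp (N * (N - 1) * J) * Real.exp (N * v)) *
              (Real.exp (-(N ^ 2 * r)) * Z ^ N)) * h2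
          rw [h1]
          calc (m * Z * Real.exp v) ^ N * Real.exp (N * (N - 1) * J - N ^ 2 * r)
              ≤ Real.exp a ^ N * Real.exp (N * (N - 1) * J - N ^ 2 * r) := by gcongr
            _ = Real.exp (N * a + (N * (N - 1) * J - N ^ 2 * r)) := by
                rw [← Real.exp_nat_mul, ← Real.exp_add]
            _ ≤ Real.exp ((a + 1) ^ 2 / (4 * c) + -N) := by
                refine Real.exp_le_exp.2 ?_
                have hN : (0 : ℝ) ≤ N := Nat.cast_nonneg N
                have h3 : (N : ℝ) * (a + 1) - c * N ^ 2 ≤ (a + 1) ^ 2 / (4 * c) := by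
                  rw [le_div_iff₀ (by positivity)]
                  nlinarith [sq_nonneg (2 * c * N - (a + 1))]
                have h4 : (N : ℝ) * J ≥ 0 := mul_nonneg hN hJ0
                simp only [c] at h3 ⊢
                nlinarith
            _ = _ := Real.exp_add _ _

lemma isProbabilityMeasure_gasMeasure {N : ℕ} (h0 : partitionFunction β V N ≠ 0)
    (h1 : partitionFunction β V N ≠ ⊤) : IsProbabilityMeasure (gasMeasure β V N) := by
  refine ⟨?_⟩
  unfold gasMeasure
  rw [Measure.smul_apply, withDensity_apply _ MeasurableSet.univ, setLIntegral_univ, smul_eq_mul]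
  exact ENNReal.inv_mul_cancel h0 h1

/-- Off the diagonal the truncation is dropped. The N diagonal terms, infinite without truncation,
cost at most M each, that is M/N in total after division by N². -/
lemma truncEnergy_empiricalMeasure_le (hβ : 0 < β) (hV : Continuous V) (hC : LogConfining β C V)
    (M : ℕ) (N : ℕ+) (x : Fin (N : ℕ) → E) :
    truncEnergy β C V M (empiricalMeasure N x) ≤
      ((N : ℕ) : ℝ≥0∞)⁻¹ * (((N : ℕ) : ℝ≥0∞)⁻¹ * negLog (interaction β C V N x) + M) := by
  have hm : Measurable fun z : E × E => min (negLog (pairWeight β C V z.1 z.2)) (M : ℝ≥0∞) :=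
    (measurable_negLog_pairWeight hβ hV).min measurable_const
  have h1 : truncEnergy β C V M (empiricalMeasure N x) = ((N : ℕ) : ℝ≥0∞)⁻¹ *
      ∑ i, ((N : ℕ) : ℝ≥0∞)⁻¹ * ∑ j, min (negLog (pairWeight β C V (x i) (x j))) (M : ℝ≥0∞) := by
    unfold truncEnergy
    rw [lintegral_prod _ hm.aemeasurable]
    change ∫⁻ a, ∫⁻ b, _ ∂(((N : ℕ) : ℝ≥0∞)⁻¹ • ∑ i, Measure.dirac (x i))
      ∂(((N : ℕ) : ℝ≥0∞)⁻¹ • ∑ i, Measure.dirac (x i)) = _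
    simp_rw [lintegral_smul_measure, lintegral_finsetSum_measure, lintegral_dirac, smul_eq_mul]
  rw [h1, negLog_interaction hβ hC, ← Finset.mul_sum]
  have hN : ((N : ℕ) : ℝ≥0∞) ≠ 0 := by simp
  have h2 : ∑ i, ∑ j, min (negLog (pairWeight β C V (x i) (x j))) (M : ℝ≥0∞) ≤
      ∑ i, ∑ j ∈ ({i}ᶜ : Finset (Fin (N : ℕ))), negLog (pairWeight β C V (x i) (x j)) +
        (N : ℕ) * (M : ℝ≥0∞) := by
    have h3 : ∑ _i : Fin (N : ℕ), (M : ℝ≥0∞) = (N : ℕ) * (M : ℝ≥0∞) := by simp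
    rw [← h3, ← Finset.sum_add_distrib]
    refine Finset.sum_le_sum fun i _ => ?_
    rw [← Finset.sum_add_sum_compl {i}, Finset.sum_singleton, add_comm]
    gcongr
    · exact min_le_left _ _
    · exact min_le_right _ _
  calc ((N : ℕ) : ℝ≥0∞)⁻¹ * (((N : ℕ) : ℝ≥0∞)⁻¹ *
        ∑ i, ∑ j, min (negLog (pairWeight β C V (x i) (x j))) (M : ℝ≥0∞))
      ≤ ((N : ℕ) : ℝ≥0∞)⁻¹ * (((N : ℕ) : ℝ≥0∞)⁻¹ *
        (∑ i, ∑ j ∈ ({i}ᶜ : Finset (Fin (N : ℕ))), negLog (pairWeight β C V (x i) (x j)) +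
        (N : ℕ) * (M : ℝ≥0∞))) := by gcongr
    _ = _ := by
      rw [mul_add (((N : ℕ) : ℝ≥0∞)⁻¹) _ ((N : ℕ) * (M : ℝ≥0∞)), ← mul_assoc _ _ (M : ℝ≥0∞),
        ENNReal.inv_mul_cancel hN (ENNReal.natCast_ne_top _), one_mul]

/-- A sequence of configurations whose interaction factors are asymptotically at least
`exp (- N² r)` for every `r` above the minimal energy has empirical measures converging to the
minimizer. -/
lemma tendsto_empiricalMeasure (hβ : 0 < β) (hV : Continuous V) (hC : LogConfining β C V)
    {μ : ProbabilityMeasure E} (hμ : mutualEnergy β C V μ μ ≠ ⊤)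
    (hmin : ∀ η : ProbabilityMeasure E, mutualEnergy β C V μ μ ≤ mutualEnergy β C V η η)
    {x : (N : ℕ+) → Fin (N : ℕ) → E}
    (hx : ∀ k : ℕ, ∀ᶠ N : ℕ+ in atTop, Real.exp (-(((N : ℕ) : ℝ) ^ 2 *
      ((mutualEnergy β C V μ μ).toReal + 1 / (k + 1)))) < interaction β C V N (x N)) :
    Tendsto (fun N : ℕ+ => empiricalMeasure N (x N)) atTop (𝓝 μ) := by
  have hpred : Tendsto PNat.natPred atTop atTop := OrderIso.pnatIsoNat.tendsto_atTop
  have hsucc : Tendsto Nat.succPNat atTop atTop := OrderIso.pnatIsoNat.symm.tendsto_atTop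
  suffices h : Tendsto (fun n : ℕ => empiricalMeasure n.succPNat (x n.succPNat)) atTop (𝓝 μ) by
    have h2 := h.comp hpred
    refine h2.congr fun N => ?_
    simp only [Function.comp]
    rw [PNat.succPNat_natPred]
  refine tendsto_minimizer hβ hV hC hμ hmin fun M b hb => ?_
  set J := (mutualEnergy β C V μ μ).toReal
  have hJ : mutualEnergy β C V μ μ = ENNReal.ofReal J := (ENNReal.ofReal_toReal hμ).symm
  have hlim : Tendsto (fun k : ℕ => ENNReal.ofReal (J + 1 / (k + 1))) atTop
      (𝓝 (ENNReal.ofReal J)) := by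
    refine (ENNReal.continuous_ofReal.tendsto J).comp ?_
    simpa using tendsto_const_nhds.add (tendsto_one_div_add_atTop_nhds_zero_nat (𝕜 := ℝ))
  rw [hJ] at hb
  obtain ⟨k, hk⟩ := (hlim.eventually_lt_const hb).exists
  have hlim2 : Tendsto (fun n : ℕ => ENNReal.ofReal (J + 1 / (k + 1)) +
      ((n.succPNat : ℕ) : ℝ≥0∞)⁻¹ * M) atTop (𝓝 (ENNReal.ofReal (J + 1 / (k + 1)))) := by
    have h1 : Tendsto (fun n : ℕ => ((n.succPNat : ℕ) : ℝ≥0∞)⁻¹) atTop (𝓝 0) := by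
      exact (tendsto_add_atTop_iff_nat 1).2 ENNReal.tendsto_inv_nat_nhds_zero
    have h2 := ENNReal.Tendsto.mul_const (b := (M : ℝ≥0∞)) h1 (Or.inr (ENNReal.natCast_ne_top M))
    simpa using tendsto_const_nhds.add h2
  filter_upwards [hlim2.eventually_lt_const hk, hsucc.eventually (hx k)] with n hn hxn
  refine (truncEnergy_empiricalMeasure_le hβ hV hC M _ _).trans (le_trans ?_ hn.le)
  set N := n.succPNat
  have h3 : negLog (interaction β C V N (x N)) ≤
      ((N : ℕ) : ℝ≥0∞) * (((N : ℕ) : ℝ≥0∞) * ENNReal.ofReal (J + 1 / (k + 1))) := by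
    refine (negLog_antitone hxn.le).trans_eq ?_
    rw [negLog_exp_neg, ENNReal.ofReal_mul (by positivity), sq,
      ENNReal.ofReal_mul (by positivity), ENNReal.ofReal_natCast, mul_assoc]
  have hN0 : ((N : ℕ) : ℝ≥0∞) ≠ 0 := by simp
  have hcancel : ∀ y : ℝ≥0∞, ((N : ℕ) : ℝ≥0∞)⁻¹ * (((N : ℕ) : ℝ≥0∞) * y) = y := fun y => by
    rw [← mul_assoc, ENNReal.inv_mul_cancel hN0 (ENNReal.natCast_ne_top _), one_mul]
  calc ((N : ℕ) : ℝ≥0∞)⁻¹ * (((N : ℕ) : ℝ≥0∞)⁻¹ * negLog (interaction β C V N (x N)) + M)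
      ≤ ((N : ℕ) : ℝ≥0∞)⁻¹ * (((N : ℕ) : ℝ≥0∞)⁻¹ *
        (((N : ℕ) : ℝ≥0∞) * (((N : ℕ) : ℝ≥0∞) * ENNReal.ofReal (J + 1 / (k + 1)))) + M) := by
        gcongr
    _ = _ := by rw [hcancel, mul_add, hcancel]

/-- The gas measures are probability measures, and almost surely the empirical measures converge
to the minimizer of the energy. -/
theorem gas_convergence [Nontrivial E] (hβ : 0 < β) (hV : Continuous V)
    (hC : LogConfining β C V) (hint : Integrable fun x : E => Real.exp (-V x)) :
    (∀ N : ℕ+, IsProbabilityMeasure (gasMeasure β V (N : ℕ))) ∧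
      ∃ μ : ProbabilityMeasure E, mutualEnergy β C V μ μ ≠ ⊤ ∧
        (∀ η : ProbabilityMeasure E, mutualEnergy β C V μ μ ≤ mutualEnergy β C V η η) ∧
        jointMeasure β V
          {x | Tendsto (fun N : ℕ+ => empiricalMeasure N (x N)) atTop (𝓝 μ)} = 1 := by
  obtain ⟨μ, hμ, hmin⟩ := exists_minimizer hβ hV hC (exists_mutualEnergy_ne_top hβ hV)
  set J := (mutualEnergy β C V μ μ).toReal
  have hlt : ∀ k : ℕ, mutualEnergy β C V μ μ < ENNReal.ofReal (J + 1 / (k + 1)) := by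
    intro k
    have h1 : (0 : ℝ) < 1 / (k + 1) := by positivity
    rw [← ENNReal.ofReal_toReal hμ]
    exact (ENNReal.ofReal_lt_ofReal_iff (by positivity)).2 (by simp only [J]; linarith)
  have hprob : ∀ N : ℕ+, IsProbabilityMeasure (gasMeasure β V (N : ℕ)) := fun N => by
    -- Any level above the minimum serves here: only Z_N ≠ 0 is extracted.
    obtain ⟨D, hD⟩ := exists_gasMeasure_interaction_le hβ hV hC hint (hlt 0)
    exact isProbabilityMeasure_gasMeasure (hD N).1
      (partitionFunction_lt_top hβ hV hC hint).ne
  refine ⟨hprob, μ, hμ, hmin, ?_⟩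
  have hae : ∀ k : ℕ, ∀ᵐ x ∂(jointMeasure β V), ∀ᶠ N : ℕ+ in atTop,
      Real.exp (-(((N : ℕ) : ℝ) ^ 2 * (J + 1 / (k + 1)))) < interaction β C V N (x N) := by
    intro k
    obtain ⟨D, hD⟩ := exists_gasMeasure_interaction_le hβ hV hC hint (hlt k)
    set A : (N : ℕ+) → Set (Fin (N : ℕ) → E) := fun N =>
      {x | interaction β C V N x ≤ Real.exp (-(((N : ℕ) : ℝ) ^ 2 * (J + 1 / (k + 1))))} with hA
    have hAm : ∀ N, MeasurableSet (A N) := fun N =>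
      measurableSet_le (continuous_interaction hβ hV).measurable measurable_const
    have hmeas : ∀ N : ℕ+, jointMeasure β V ((fun x => x N) ⁻¹' A N) = gasMeasure β V N (A N) :=
      fun N => (measurePreserving_eval_infinitePi (fun N : ℕ+ => gasMeasure β V (N : ℕ))
        N).measure_preimage (hAm N).nullMeasurableSet
    -- Borel–Cantelli in its first form: summability of the marginal probabilities suffices, without
    -- independence.
    have hsum : ∑' N : ℕ+, jointMeasure β V ((fun x => x N) ⁻¹' A N) ≠ ⊤ := by
      have hs : Summable fun N : ℕ+ => Real.exp D * Real.exp (-((N : ℕ) : ℝ)) :=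
        (Real.summable_exp_neg_nat.comp_injective PNat.coe_injective).mul_left _
      refine ne_top_of_le_ne_top hs.tsum_ofReal_ne_top (ENNReal.tsum_le_tsum fun N => ?_)
      rw [hmeas]
      exact (hD N).2
    filter_upwards [ae_finite_setOfPred_mem hsum] with x hx
    have hcof : ∀ᶠ N : ℕ+ in cofinite, x ∉ (fun x => x N) ⁻¹' A N := by
      rw [Filter.eventually_cofinite]
      simpa using hx
    filter_upwards [atTop_le_cofinite hcof] with N hN
    simpa [hA] using hN
  have hprobJ : IsProbabilityMeasure (jointMeasure β V) := by
    unfold jointMeasure; infer_instance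
  have hconv : ∀ᵐ x ∂(jointMeasure β V),
      Tendsto (fun N : ℕ+ => empiricalMeasure N (x N)) atTop (𝓝 μ) := by
    filter_upwards [ae_all_iff.2 hae] with x hx
    exact tendsto_empiricalMeasure hβ hV hC hμ hmin hx
  rw [measure_eq_measure_of_null_sdiff (Set.subset_univ _) ?_, measure_univ]
  rw [← Set.compl_eq_univ_sdiff]
  exact hconv

end Concentration

/-! ### Comparison of J with the extended-real energy I_V -/

section ExtendedRealEnergy

variable {E : Type*} [NormedAddCommGroup E] [InnerProductSpace ℝ E]
  {β C : ℝ} {V : E → ℝ}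

lemma kernel_self (x : E) : kernel β V x x = ⊤ := by simp [kernel]

lemma negLog_pairWeight_of_ne {x y : E} (h : x ≠ y) :
    negLog (pairWeight β C V x y) =
      ENNReal.ofReal (β / 2 * Real.log (1 / ‖x - y‖) + 1 / 2 * V x + 1 / 2 * V y + C) := by
  have h0 : 0 < ‖x - y‖ := norm_pos_iff.2 (sub_ne_zero.2 h)
  rw [negLog_of_pos (pairWeight_pos h)]
  unfold pairWeight
  rw [Real.log_mul (by positivity) (Real.exp_pos _).ne', Real.log_rpow h0, Real.log_exp, one_div,
    Real.log_inv]
  congr 1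
  ring

/-- The identity (F + C) + F⁻ = F⁺ + C, arranged without subtraction so that it makes sense in
[0,∞], including F = ∞ on the diagonal. -/
lemma negLog_pairWeight_add_negPart (hβ : 0 < β) (hC0 : 0 ≤ C) (hC : LogConfining β C V)
    (x y : E) : negLog (pairWeight β C V x y) + (-kernel β V x y).toENNReal =
      (kernel β V x y).toENNReal + ENNReal.ofReal C := by
  by_cases h : x = y
  · subst h
    simp [kernel_self, pairWeight_self hβ]
  · have hle := pairWeight_le_one hβ hC x y
    have h0 := Real.log_nonpos (pairWeight_nonneg _ _) hle
    have h1 : 0 ≤ β / 2 * Real.log (1 / ‖x - y‖) + 1 / 2 * V x + 1 / 2 * V y + C := by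
      have hp : 0 < ‖x - y‖ := norm_pos_iff.2 (sub_ne_zero.2 h)
      unfold pairWeight at h0
      rw [Real.log_mul (by positivity) (Real.exp_pos _).ne', Real.log_rpow hp,
        Real.log_exp] at h0
      rw [one_div, Real.log_inv]
      linarith
    rw [negLog_pairWeight_of_ne h]
    simp only [kernel, h, if_false]
    set r := β / 2 * Real.log (1 / ‖x - y‖) + 1 / 2 * V x + 1 / 2 * V y
    rw [← EReal.coe_neg, EReal.toENNReal_of_ne_top (EReal.coe_ne_top _),
      EReal.toENNReal_of_ne_top (EReal.coe_ne_top _), EReal.toReal_coe, EReal.toReal_coe]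
    rcases le_total 0 r with hr | hr
    · rw [ENNReal.ofReal_of_nonpos (neg_nonpos.2 hr), add_zero, ENNReal.ofReal_add hr hC0]
    · rw [ENNReal.ofReal_of_nonpos hr, zero_add, ← ENNReal.ofReal_add h1 (neg_nonneg.2 hr)]
      congr 1
      ring

variable [FiniteDimensional ℝ E] [MeasurableSpace E] [BorelSpace E]

lemma measurable_kernel (hV : Continuous V) :
    Measurable fun z : E × E => kernel β V z.1 z.2 := by
  have := hV.measurable
  unfold kernel
  refine Measurable.ite (measurableSet_eq_fun measurable_fst measurable_snd) measurable_const ?_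
  exact (by fun_prop : Measurable fun z : E × E => β / 2 * Real.log (1 / ‖z.1 - z.2‖) +
    1 / 2 * V z.1 + 1 / 2 * V z.2).coe_real_ereal

/-- The energy `I_V` is the energy of the nonnegative kernel `F_V + C` up to the constant `C`. -/
lemma energy_add_const (hβ : 0 < β) (hC0 : 0 ≤ C) (hV : Continuous V) (hC : LogConfining β C V)
    (μ : ProbabilityMeasure E) :
    energy β V μ + (C : EReal) = (mutualEnergy β C V μ μ : EReal) := by
  have hk := measurable_kernel (β := β) hV
  set p := ∫⁻ z : E × E, (kernel β V z.1 z.2).toENNReal ∂((μ : Measure E).prod (μ : Measure E))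
    with hp
  set n := ∫⁻ z : E × E, (-kernel β V z.1 z.2).toENNReal ∂((μ : Measure E).prod (μ : Measure E))
    with hn
  have hadd : mutualEnergy β C V μ μ + n = p + ENNReal.ofReal C := by
    have h1 : p + ENNReal.ofReal C = ∫⁻ z : E × E, (kernel β V z.1 z.2).toENNReal +
        ENNReal.ofReal C ∂((μ : Measure E).prod (μ : Measure E)) := by
      rw [lintegral_add_right _ measurable_const, ← hp]
      simp
    rw [h1, hn]
    unfold mutualEnergy
    rw [← lintegral_add_left (measurable_negLog_pairWeight hβ hV)]
    exact lintegral_congr fun z => negLog_pairWeight_add_negPart hβ hC0 hC _ _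
  -- F_V ≥ −C bounds the negative part, so the difference defining I_V is never ∞ − ∞.
  have hnC : n ≤ ENNReal.ofReal C := by
    have h2 : ∀ z : E × E, (-kernel β V z.1 z.2).toENNReal ≤ ENNReal.ofReal C := by
      intro z
      have h := negLog_pairWeight_add_negPart hβ hC0 hC z.1 z.2
      by_cases hz : kernel β V z.1 z.2 ≤ 0
      · rw [EReal.toENNReal_of_nonpos hz, zero_add] at h
        exact h ▸ le_add_self
      · rw [EReal.toENNReal_of_nonpos (EReal.neg_le_zero.2 (not_le.1 hz).le)]
        exact zero_le
    calc n ≤ ∫⁻ z : E × E, ENNReal.ofReal C ∂((μ : Measure E).prod (μ : Measure E)) :=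
          lintegral_mono h2
      _ = ENNReal.ofReal C := by simp
  have hn_top : n ≠ ⊤ := ne_top_of_le_ne_top ENNReal.ofReal_ne_top hnC
  change (p : EReal) - (n : EReal) + (C : EReal) = _
  set J := mutualEnergy β C V (μ : Measure E) (μ : Measure E)
  clear_value p n J
  lift n to NNReal using hn_top
  by_cases hpt : p = ⊤
  · have hJ : J = ⊤ := by
      rw [hpt, top_add] at hadd
      by_contra hJ
      exact ENNReal.add_ne_top.2 ⟨hJ, ENNReal.coe_ne_top⟩ hadd
    rw [hpt, hJ]
    rfl
  · have hJ : J ≠ ⊤ := fun hJ => by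
      rw [hJ, top_add] at hadd
      exact ENNReal.add_ne_top.2 ⟨hpt, ENNReal.ofReal_ne_top⟩ hadd.symm
    lift p to NNReal using hpt
    lift J to NNReal using hJ
    have h3 : (J : ℝ) + n = p + C := by
      have := congrArg ENNReal.toReal hadd
      rw [ENNReal.toReal_add (by simp) (by simp), ENNReal.toReal_add (by simp) (by simp),
        ENNReal.toReal_ofReal hC0] at this
      simpa using this
    change ((p : ℝ) : EReal) - ((n : ℝ) : EReal) + (C : EReal) = ((J : ℝ) : EReal)
    rw [← EReal.coe_sub, ← EReal.coe_add]
    congr 1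
    linarith

lemma energy_le_energy_iff (hβ : 0 < β) (hC0 : 0 ≤ C) (hV : Continuous V)
    (hC : LogConfining β C V) (μ ν : ProbabilityMeasure E) :
    energy β V μ ≤ energy β V ν ↔ mutualEnergy β C V μ μ ≤ mutualEnergy β C V ν ν := by
  rw [← EReal.coe_ennreal_le_coe_ennreal_iff, ← energy_add_const hβ hC0 hV hC μ,
    ← energy_add_const hβ hC0 hV hC ν]
  exact ((EReal.addLECancellable_coe C).add_le_add_iff_right).symm

lemma isUniqueMinimizer_of_mutualEnergy (hβ : 0 < β) (hC0 : 0 ≤ C) (hV : Continuous V)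
    (hC : LogConfining β C V) {μ : ProbabilityMeasure E} (hμ : mutualEnergy β C V μ μ ≠ ⊤)
    (hmin : ∀ η : ProbabilityMeasure E, mutualEnergy β C V μ μ ≤ mutualEnergy β C V η η) :
    IsUniqueMinimizer β V μ := by
  refine ⟨fun ν => (energy_le_energy_iff hβ hC0 hV hC μ ν).2 (hmin ν), fun μ' h => ?_⟩
  exact Subtype.ext (minimizer_unique (μ := (μ' : Measure E)) (ν := (μ : Measure E)) hβ hV hC hμ
    hmin ((energy_le_energy_iff hβ hC0 hV hC μ' μ).1 (h μ)) le_rfl)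

end ExtendedRealEnergy

/-! ### Consequences of the growth condition -/

section Growth

variable {E : Type*} [NormedAddCommGroup E] [ProperSpace E] {β β' C : ℝ} {V : E → ℝ}

/-- Under the weak growth condition, `V` dominates `(β' / 2) log (1 + |x|²)` up to a constant. -/
lemma WeakGrowth.exists_logConfining (hβ' : 0 ≤ β') (hV : Continuous V)
    (h : WeakGrowth β' V) : ∃ C, 0 ≤ C ∧ LogConfining β' C V := by
  obtain ⟨c, hc0, hc⟩ := exists_between h
  obtain ⟨c, rfl⟩ : ∃ c' : ℝ, (c' : EReal) = c :=
    ⟨c.toReal, EReal.coe_toReal hc.ne_top hc0.ne'⟩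
  have hev := eventually_lt_of_lt_liminf hc
  have hbdd : Bornology.IsBounded
      {x : E | (c : EReal) < ((V x - β' * Real.log ‖x‖ : ℝ) : EReal)}ᶜ := by
    rw [Bornology.isBounded_def, compl_compl]
    exact hev
  obtain ⟨R, hR⟩ := (Metric.isBounded_iff_subset_closedBall (0 : E)).1 hbdd
  obtain ⟨B, hB⟩ := (isCompact_closedBall (0 : E) (max R 1)).bddAbove_image
    (f := fun x : E => β' / 2 * Real.log (1 + ‖x‖ ^ 2) - V x) (by
      refine Continuous.continuousOn ?_
      exact (continuous_const.mul (Continuous.log (by fun_prop) fun x => by positivity)).sub hV)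
  -- On the ball, B bounds the difference by compactness. Outside it |x| > 1, so 1 + |x|² ≤ 2|x|²,
  -- which accounts for (β'/2) log 2 − c. The 0 ensures C ≥ 0, needed to compare I_V with J.
  refine ⟨max 0 (max B (β' / 2 * Real.log 2 - c)), le_max_left _ _, fun x => ?_⟩
  rw [sub_le_comm]
  by_cases hx : x ∈ Metric.closedBall (0 : E) (max R 1)
  · exact (hB (Set.mem_image_of_mem _ hx)).trans ((le_max_left _ _).trans (le_max_right _ _))
  · refine le_trans ?_ ((le_max_right _ _).trans (le_max_right _ _))
    have hxn : max R 1 < ‖x‖ := by simpa using hx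
    have h1 : 1 < ‖x‖ := (le_max_right _ _).trans_lt hxn
    have h2 : c < V x - β' * Real.log ‖x‖ := by
      by_contra hcon
      have hmem : x ∈ Metric.closedBall (0 : E) R :=
        hR fun hmem => hcon (EReal.coe_lt_coe_iff.1 hmem)
      rw [mem_closedBall_zero_iff] at hmem
      linarith [(le_max_left R 1)]
    have h3 : Real.log (1 + ‖x‖ ^ 2) ≤ Real.log 2 + 2 * Real.log ‖x‖ := by
      have : Real.log (2 * ‖x‖ ^ 2) = Real.log 2 + 2 * Real.log ‖x‖ := by
        rw [Real.log_mul (by norm_num) (by positivity), Real.log_pow]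
        norm_num
      rw [← this]
      exact Real.log_le_log (by positivity) (by nlinarith)
    nlinarith [mul_le_mul_of_nonneg_left h3 (by linarith : 0 ≤ β' / 2)]

lemma LogConfining.mono (hββ' : β ≤ β') (h : LogConfining β' C V) : LogConfining β C V := by
  intro x
  have h1 : 0 ≤ Real.log (1 + ‖x‖ ^ 2) := Real.log_nonneg (by nlinarith [norm_nonneg x])
  have := h x
  nlinarith

/-- Comparison with (1+x²)^{−β'/2}, integrable on the line precisely because β' > 1. Confinement is
therefore kept at β' here, and weakened to β only for the energy. -/
lemma LogConfining.integrable_exp_neg {V : ℝ → ℝ} (hβ' : 1 < β') (hV : Continuous V)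
    (h : LogConfining β' C V) : Integrable fun x => Real.exp (-V x) := by
  have h1 : Integrable fun x : ℝ => Real.exp C * (1 + ‖x‖ ^ 2) ^ (-β' / 2) :=
    (integrable_rpow_neg_one_add_norm_sq (by simpa using hβ')).const_mul _
  refine h1.mono' (by fun_prop : Continuous fun x => Real.exp (-V x)).aestronglyMeasurable
    (ae_of_all _ fun x => ?_)
  rw [Real.norm_eq_abs, Real.abs_exp, Real.rpow_def_of_pos (by positivity), ← Real.exp_add]
  refine Real.exp_le_exp.2 ?_
  have := h x
  linarith

/-- For a single particle there are no pairs, so Z_1 is exactly ∫ e^{−V}. -/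
lemma integrable_exp_neg_of_partitionFunction_one {E : Type*} [NormedAddCommGroup E]
    [MeasureSpace E] [BorelSpace E] [SecondCountableTopology E]
    [SigmaFinite (volume : Measure E)] {V : E → ℝ} (hV : Continuous V)
    (h : partitionFunction β V 1 < ⊤) : Integrable fun x => Real.exp (-V x) := by
  refine ⟨(by fun_prop : Continuous fun x => Real.exp (-V x)).aestronglyMeasurable, ?_⟩
  rw [hasFiniteIntegral_iff_ofReal (ae_of_all _ fun x => (Real.exp_pos _).le)]
  convert! h using 1
  unfold partitionFunction
  have hmp := volume_preserving_funUnique (Fin 1) E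
  rw [← hmp.map_eq, lintegral_map_equiv]
  refine lintegral_congr fun x => ?_
  simp [gasWeight]

end Growth

/-! ### Assembly of the theorem -/

section Main

variable {E : Type*} [NormedAddCommGroup E] [InnerProductSpace ℝ E]
  [FiniteDimensional ℝ E] [MeasureSpace E] [BorelSpace E]
  [(volume : Measure E).IsAddHaarMeasure]

theorem gas_convergence_uniqueMinimizer [Nontrivial E] {β C : ℝ} {V : E → ℝ} (hβ : 0 < β)
    (hV : Continuous V) (hC0 : 0 ≤ C) (hC : LogConfining β C V)
    (hint : Integrable fun x : E => Real.exp (-V x)) :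
    (∀ N : ℕ+, IsProbabilityMeasure (gasMeasure β V (N : ℕ))) ∧
      ∃ μ : ProbabilityMeasure E, IsUniqueMinimizer β V μ ∧
        jointMeasure β V
          {x | Tendsto (fun N : ℕ+ => empiricalMeasure N (x N)) atTop (𝓝 μ)} = 1 := by
  obtain ⟨hprob, μ, hμ, hmin, hconv⟩ := gas_convergence hβ hV hC hint
  exact ⟨hprob, μ, isUniqueMinimizer_of_mutualEnergy hβ hC0 hV hC hμ hmin, hconv⟩

end Main

end CoulombGas

end

theorem corollary1 (β β' : ℝ) (hβ : 0 < β) (hβ' : 1 < β') (hββ' : β ≤ β') :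
    (∀ V : ℝ → ℝ, Continuous V → CoulombGas.WeakGrowth β' V →
      (∀ N : ℕ+, IsProbabilityMeasure (CoulombGas.gasMeasure β V (N : ℕ))) ∧
      ∃ μ : ProbabilityMeasure ℝ, CoulombGas.IsUniqueMinimizer β V μ ∧
        CoulombGas.jointMeasure β V
          {x | Tendsto (fun N : ℕ+ => CoulombGas.empiricalMeasure N (x N)) atTop (𝓝 μ)} = 1) ∧
    (∀ V : ℂ → ℝ, Continuous V → CoulombGas.WeakGrowth β' V →
      (∀ N : ℕ+, CoulombGas.partitionFunction β V (N : ℕ) < ⊤) →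
      (∀ N : ℕ+, IsProbabilityMeasure (CoulombGas.gasMeasure β V (N : ℕ))) ∧
      ∃ μ : ProbabilityMeasure ℂ, CoulombGas.IsUniqueMinimizer β V μ ∧
        CoulombGas.jointMeasure β V
          {x | Tendsto (fun N : ℕ+ => CoulombGas.empiricalMeasure N (x N)) atTop (𝓝 μ)} = 1) := by

  refine ⟨fun V hV hG => ?_, fun V hV hG hZ => ?_⟩
  · obtain ⟨C, hC0, hC⟩ := hG.exists_logConfining (by linarith) hV
    exact CoulombGas.gas_convergence_uniqueMinimizer hβ hV hC0 (hC.mono hββ')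
      (hC.integrable_exp_neg hβ' hV)
  · obtain ⟨C, hC0, hC⟩ := hG.exists_logConfining (by linarith) hV
    exact CoulombGas.gas_convergence_uniqueMinimizer hβ hV hC0 (hC.mono hββ')
      (CoulombGas.integrable_exp_neg_of_partitionFunction_one hV (hZ 1))
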